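/- Let $\mathbb F=\mathbb F_m$ be the free group with $m$ generators, $e$ its unit and $|s|$ the length of the reduced word $s$, and let $\mathcal H$ be a complex Hilbert space. Fix a lexicographic order $\preceq$ on $\mathbb F$: a total order in which $|s|<|t|$ implies $s\preceq t$, and in which distinct words of the same length are ordered like the first letters in which they differ (letters being generators and their inverses, as elements of $\mathbb F$). Let $\hat{\mathbb F}$ be the set of classes $\nu=\{s,s^{-1}\}$, ordered by their least elements $s_\nu$, let $\nu^-$ be the predecessor of $\nu\ne\{e\}$, and put $\Sigma_\nu=\bigcup_{\nu'\preceq\nu}\nu'$. Let $\Gamma_\nu$ be the graph on $\mathbb F$ in which $s\neq t$ are adjacent iff $s^{-1}t\in\Sigma_\nu$. For $\nu\neq\{e\}$ let $C_\nu$ be the maximal clique of $\Gamma_\nu$ containing $e$ and $s_\nu$ (it is unique and finite). A function $\varphi$ with values in $\mathcal L(\mathcal H)$ on a set $\Sigma=\Sigma^{-1}\subset\mathbb F$ is positive definite if the operator matrix $[\varphi(s_i^{-1}s_j)]_{i,j=1}^k$ is positive semidefinite for all $s_1,\dots,s_k\in\Sigma$ such that all $s_i^{-1}s_j$ are in $\Sigma$;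 it is normalized if $\varphi(e)=I_{\mathcal H}$. For a finite set $S$ for which $A(\varphi;S)=[\varphi(s^{-1}t)]_{s,t\in S}$ is defined and positive semidefinite, let $\mathcal R(A(\varphi;S))\subset\bigoplus_{S}\mathcal H$ be its realization space, that is, the closed span of the spaces $\omega_t\mathcal H$, $t\in S$, where $\omega_t=A(\varphi;S)^{1/2}\iota_t$ and $\iota_t$ is the embedding of $\mathcal H$ as the $t$-th summand. Thus $\omega_s^*\omega_t=\varphi(s^{-1}t)$. For $T\subset S$ the space $\mathcal R(A(\varphi;T))$ is identified with a subspace of $\mathcal R(A(\varphi;S))$ by the isometry that intertwines the maps $\omega_t$, $t\in T$. For $\varphi$ positive definite on a set of the form $\Sigma_{\mu'}$ that contains $\Sigma_{\mu^-}$, or on all of $\mathbb F$, put $$\mathbf D(\varphi|\Sigma_{\mu^-})=\mathcal R(A(\varphi;C_\mu\setminus\{s_\mu\}))\ominus\mathcal R(A(\varphi;C_\mu\setminus\{e,s_\mu\})),$$ $$\mathbf R(\varphi|\Sigma_{\mu^-})=\mathcal R(A(\varphi;C_\mu\setminus\{e\}))\ominus\mathcal R(A(\varphi;C_\mu\setminus\{e,s_\mu\})).$$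 These spaces depend only on $\varphi|\Sigma_{\mu^-}$. If $\varphi$ is positive definite on a set of this form that contains $\Sigma_\mu$, its parameter at $\mu$ is the operator $$\gamma_\mu(\varphi)=P_{\mathbf R(\varphi|\Sigma_{\mu^-})}\big|\mathbf D(\varphi|\Sigma_{\mu^-}):\mathbf D(\varphi|\Sigma_{\mu^-})\to\mathbf R(\varphi|\Sigma_{\mu^-}),$$ both spaces being regarded as subspaces of $\mathcal R(A(\varphi;C_\mu))$. **Theorem 4.5.** The map $\Phi\mapsto(\gamma_\mu(\Phi))_{\mu\neq\{e\}}$ is a one-to-one correspondence between the set of all positive definite functions $\Phi:\mathbb F\to\mathcal L(\mathcal H)$ with $\Phi(e)=I_{\mathcal H}$ and the set of all sequences of contractions $(\gamma_\mu)_{\mu\neq\{e\}}$ with $\gamma_\mu:\mathbf D(\Phi|\Sigma_{\mu^-})\to\mathbf R(\Phi|\Sigma_{\mu^-})$. Here the domain and range of $\gamma_\mu$ are determined by the preceding $\gamma_\nu$, $\nu\prec\mu$: a family $(\gamma_\mu)$ is such a sequence iff, for every $\mu\neq\{e\}$ and every normalized positive definite function $\varphi$ on $\Sigma_{\mu^-}$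 with $\gamma_\nu(\varphi)=\gamma_\nu$ for all $\nu\prec\mu$, $\gamma_\mu$ is a contraction from $\mathbf D(\varphi)$ to $\mathbf R(\varphi)$. -/

import Mathlib

open scoped InnerProductSpace

namespace FreeGroupPD

noncomputable section

/-! ### Block operator matrices and their realizations -/

section Blocks

variable {H : Type*} [NormedAddCommGroup H] [InnerProductSpace ℂ H] [CompleteSpace H]

/-- The Hilbert space direct sum `⨁_{i ∈ ι} H`, for a finite index set `ι`. -/
abbrev DSum (H : Type*) [NormedAddCommGroup H] [InnerProductSpace ℂ H]
    (ι : Type*) [Fintype ι] : Type _ :=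
  PiLp 2 (fun _ : ι => H)

/-- The `i`-th coordinate `⨁ H → H`. -/
def coord (H : Type*) [NormedAddCommGroup H] [InnerProductSpace ℂ H]
    {ι : Type*} [Fintype ι] (i : ι) : DSum H ι →L[ℂ] H :=
  PiLp.proj 2 (fun _ : ι => H) i

/-- The canonical embedding of `H` into the `i`-th summand of `⨁ H`
(the adjoint of the `i`-th coordinate). -/
def emb (H : Type*) [NormedAddCommGroup H] [InnerProductSpace ℂ H] [CompleteSpace H]
    {ι : Type*} [Fintype ι] (i : ι) : H →L[ℂ] DSum H ι :=
  ContinuousLinearMap.adjoint (coord H i)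

/-- The operator on `⨁_{i ∈ ι} H` given by the block operator matrix `[A i j]`. -/
def blockOp {ι : Type*} [Fintype ι] (A : ι → ι → (H →L[ℂ] H)) : DSum H ι →L[ℂ] DSum H ι :=
  ∑ i, ∑ j, emb H i ∘L A i j ∘L coord H j

/-- The square root `T^{1/2}` of a positive operator on a Hilbert space. -/
def opSqrt {E : Type*} [NormedAddCommGroup E] [InnerProductSpace ℂ E] [CompleteSpace E]
    (T : E →L[ℂ] E) : E →L[ℂ] E :=
  CFC.sqrt T

end Blocks

/-! ### Lexicographic orders on the free group -/

/-- The free group with `m` generators. -/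
abbrev FG (m : ℕ) : Type := FreeGroup (Fin m)

/-- A total order on the free group is lexicographic if shorter words come first, and two
reduced words of the same length, with common beginning `u` and first distinct letters `a`, `b`,
are ordered like the letters `a` and `b` (letters are generators and inverses of generators,
viewed as elements of the group). -/
class IsLexicographic (m : ℕ) [LinearOrder (FG m)] : Prop where
  le_of_norm_lt : ∀ s t : FG m, s.norm < t.norm → s ≤ t
  le_of_letter_le : ∀ (s t : FG m) (u v w : List (Fin m × Bool)) (a b : Fin m × Bool),
    s.norm = t.norm → s.toWord = u ++ a :: v → t.toWord = u ++ b :: w → a ≠ b →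
      FreeGroup.mk [a] ≤ FreeGroup.mk [b] → s ≤ t

section Order

variable {m : ℕ} [LinearOrder (FG m)]

/-- The classes `ν = {s, s⁻¹} ≠ {e}`. A class is given by its least element `s_ν`, and the order
of the classes is the order of these elements. -/
abbrev Cls (m : ℕ) [LinearOrder (FG m)] : Type := {s : FG m // s ≠ 1 ∧ s ≤ s⁻¹}

/-- `Σ_ν`, the union of all classes `ν' ≼ ν`. -/
def upTo (ν : Cls m) : Set (FG m) := {t | min t t⁻¹ ≤ ν.1}

/-- `Σ_{ν⁻}`, with `ν⁻` the predecessor of `ν`: the union of all classes `ν' ≺ ν`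
(among them `{e}`). -/
def below (ν : Cls m) : Set (FG m) := {t | min t t⁻¹ < ν.1}

/-- The graph `Γ_ν` on the free group: distinct `s` and `t` are adjacent iff `s⁻¹ t ∈ Σ_ν`. -/
def graph (ν : Cls m) : SimpleGraph (FG m) where
  Adj s t := s ≠ t ∧ s⁻¹ * t ∈ upTo ν
  symm := ⟨by
    rintro s t ⟨h, h'⟩
    refine ⟨h.symm, ?_⟩
    have e : (s⁻¹ * t)⁻¹ = t⁻¹ * s := by group
    have e' : (t⁻¹ * s)⁻¹ = s⁻¹ * t := by group
    change min (s⁻¹ * t) (s⁻¹ * t)⁻¹ ≤ ν.1 at h'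
    change min (t⁻¹ * s) (t⁻¹ * s)⁻¹ ≤ ν.1
    rw [e] at h'
    rwa [e', min_comm]⟩
  loopless := ⟨fun _ h => h.1 rfl⟩

/-- The maximal clique of `Γ_ν` that contains `e` and `s_ν`, as a set: the union of all cliques
that contain both (there is only one maximal such clique because `Γ_ν` is chordal for each `ν`). -/
def cliqueSet (ν : Cls m) : Set (FG m) :=
  ⋃₀ {K | (graph ν).IsClique K ∧ 1 ∈ K ∧ ν.1 ∈ K}

theorem finite_cliqueSet [IsLexicographic m] (ν : Cls m) : (cliqueSet ν).Finite := by
  have hfin : {t : FG m | t.norm ≤ ν.1.norm}.Finite :=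
    (List.finite_length_le (Fin m × Bool) ν.1.norm).preimage
      (f := FreeGroup.toWord) FreeGroup.toWord_injective.injOn
  refine hfin.subset ?_
  rintro t ⟨K, ⟨hK, h1, -⟩, ht⟩
  by_cases h : (1 : FG m) = t
  · subst h; simp
  have hadj := (hK h1 ht h).2
  change t.norm ≤ ν.1.norm
  by_contra hn
  have hn' : ν.1.norm < t.norm := not_le.mp hn
  change min ((1 : FG m)⁻¹ * t) ((1 : FG m)⁻¹ * t)⁻¹ ≤ ν.1 at hadj
  rw [inv_one, one_mul, min_le_iff] at hadj
  rcases hadj with h' | h'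
  · exact hn (by rw [le_antisymm h' (IsLexicographic.le_of_norm_lt _ _ hn')])
  · have := le_antisymm h' (IsLexicographic.le_of_norm_lt _ _ (by simpa using hn'))
    exact hn (by rw [← this]; simp)

/-- The maximal clique `C_ν` of `Γ_ν` that contains `e` and `s_ν`. -/
def clique [IsLexicographic m] (ν : Cls m) : Finset (FG m) := (finite_cliqueSet ν).toFinset

/-- `C_ν ∖ {s_ν}`. -/
abbrev cliqueD [IsLexicographic m] (ν : Cls m) : Finset (FG m) := (clique ν).erase ν.1

/-- `C_ν ∖ {e}`. -/
abbrev cliqueR [IsLexicographic m] (ν : Cls m) : Finset (FG m) := (clique ν).erase 1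

end Order

/-! ### Positive definite functions -/

section PositiveDefinite

variable {m : ℕ} {H : Type*} [NormedAddCommGroup H] [InnerProductSpace ℂ H] [CompleteSpace H]

/-- `φ`, restricted to the set `S`, is positive definite: the operator matrix `[φ(sᵢ⁻¹ sⱼ)]` is
positive semidefinite for all `s₁, …, s_k ∈ S` such that all `sᵢ⁻¹ sⱼ` are in `S`.
The values of `φ` outside `S` are irrelevant. -/
def PosDefOn (S : Set (FG m)) (φ : FG m → (H →L[ℂ] H)) : Prop :=
  ∀ (k : ℕ) (s : Fin k → FG m), (∀ i, s i ∈ S) → (∀ i j, (s i)⁻¹ * s j ∈ S) →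
    (blockOp fun i j => φ ((s i)⁻¹ * s j)).IsPositive

/-- The operator matrix `A(φ; S) = [φ(s⁻¹ t)]_{s, t ∈ S}`. -/
def kernelOp (φ : FG m → (H →L[ℂ] H)) (S : Finset (FG m)) : DSum H S →L[ℂ] DSum H S :=
  blockOp fun s t : S => φ ((s : FG m)⁻¹ * t)

/-- The maps `ω_t = A(φ; S)^{1/2} ι_t` of the realization of `A(φ; S)`. -/
def omega (φ : FG m → (H →L[ℂ] H)) (S : Finset (FG m)) (t : S) : H →L[ℂ] DSum H S :=
  opSqrt (kernelOp φ S) ∘L emb H t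

/-- The closed linear span of the spaces `ω_t H`, `t ∈ T`, in the realization of `A(φ; S)`. For
`T ⊆ S` it is the isometric copy of the realization space `ℛ(A(φ; T))` in `ℛ(A(φ; S))`. -/
def spanIn (φ : FG m → (H →L[ℂ] H)) (S T : Finset (FG m)) : Submodule ℂ (DSum H S) :=
  (⨆ t : {t : S // (t : FG m) ∈ T}, (omega φ S t.1).range).topologicalClosure

/-- The realization space `ℛ(A(φ; S))`. -/
def realization (φ : FG m → (H →L[ℂ] H)) (S : Finset (FG m)) : Submodule ℂ (DSum H S) :=
  spanIn φ S S

variable [LinearOrder (FG m)] [IsLexicographic m]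

/-- `𝐃(φ|Σ_{ν⁻}) = ℛ(A(φ; C_ν ∖ {s_ν})) ⊖ ℛ(A(φ; C_ν ∖ {e, s_ν}))`. -/
def domSpace (φ : FG m → (H →L[ℂ] H)) (ν : Cls m) : Submodule ℂ (DSum H (cliqueD ν)) :=
  realization φ (cliqueD ν) ⊓ (spanIn φ (cliqueD ν) ((cliqueD ν).erase 1))ᗮ

/-- `𝐑(φ|Σ_{ν⁻}) = ℛ(A(φ; C_ν ∖ {e})) ⊖ ℛ(A(φ; C_ν ∖ {e, s_ν}))`. -/
def ranSpace (φ : FG m → (H →L[ℂ] H)) (ν : Cls m) : Submodule ℂ (DSum H (cliqueR ν)) :=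
  realization φ (cliqueR ν) ⊓ (spanIn φ (cliqueR ν) ((cliqueR ν).erase ν.1))ᗮ

/-- A family of operators indexed by the classes `μ ≠ {e}`. The operators `γ_μ` between the closed
subspaces `𝐃 ⊆ ⨁_{C_μ ∖ {s_μ}} H` and `𝐑 ⊆ ⨁_{C_μ ∖ {e}} H` are recorded as operators
between the ambient spaces, see `IsBetween`. -/
abbrev OpSeq (m : ℕ) [LinearOrder (FG m)] [IsLexicographic m]
    (H : Type*) [NormedAddCommGroup H] [InnerProductSpace ℂ H] : Type _ :=
  ∀ μ : Cls m, DSum H (cliqueD μ) →L[ℂ] DSum H (cliqueR μ)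

/-- `g` is (the extension by zero on the orthogonal complement of `D` of) an operator `D → R`. -/
def IsBetween {E F : Type*} [NormedAddCommGroup E] [InnerProductSpace ℂ E]
    [NormedAddCommGroup F] [InnerProductSpace ℂ F]
    (D : Submodule ℂ E) (R : Submodule ℂ F) (g : E →L[ℂ] F) : Prop :=
  (∀ x ∈ Dᗮ, g x = 0) ∧ ∀ x, g x ∈ R

/-- `V` restricts to the canonical isometric embedding `ℛ(A(φ; T)) → ℛ(A(φ; S))`, `T ⊆ S`, which
intertwines the maps `ω_t`, `t ∈ T`. -/
def IsEmbedding (φ : FG m → (H →L[ℂ] H)) {T S : Finset (FG m)} (hTS : T ⊆ S)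
    (V : DSum H T →L[ℂ] DSum H S) : Prop :=
  (∀ (t : T) (h : H), V (omega φ T t h) = omega φ S ⟨t, hTS t.2⟩ h) ∧
    ∀ x ∈ realization φ T, ‖V x‖ = ‖x‖

/-- `g` is the parameter of `φ` at `μ`: the operator `P_𝐑 | 𝐃` from `𝐃 = 𝐃(φ|Σ_{μ⁻})` to
`𝐑 = 𝐑(φ|Σ_{μ⁻})`, both seen as subspaces of `ℛ(A(φ; C_μ))` by the canonical embeddings. -/
def IsParameter (φ : FG m → (H →L[ℂ] H)) (μ : Cls m)
    (g : DSum H (cliqueD μ) →L[ℂ] DSum H (cliqueR μ)) : Prop :=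
  IsBetween (domSpace φ μ) (ranSpace φ μ) g ∧
    ∃ (V : DSum H (cliqueD μ) →L[ℂ] DSum H (clique μ))
      (W : DSum H (cliqueR μ) →L[ℂ] DSum H (clique μ)),
      IsEmbedding φ (Finset.erase_subset _ _) V ∧ IsEmbedding φ (Finset.erase_subset _ _) W ∧
        ∀ x ∈ domSpace φ μ, ∀ y ∈ ranSpace φ μ, ⟪y, g x⟫_ℂ = ⟪W y, V x⟫_ℂ

/-- `γ` is a sequence of contractions `γ_μ : 𝐃(φ|Σ_{μ⁻}) → 𝐑(φ|Σ_{μ⁻})`, where the domain and the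
range of `γ_μ` are those determined by the preceding `γ_ν`, `ν ≺ μ`: they are formed with any
normalized positive definite function `φ` on `Σ_{μ⁻}` that has the parameters `γ_ν` for `ν ≺ μ`. -/
def IsContractionSeq (γ : OpSeq m H) : Prop :=
  ∀ (μ : Cls m) (φ : FG m → (H →L[ℂ] H)), PosDefOn (below μ) φ → φ 1 = 1 →
    (∀ ν < μ, IsParameter φ ν (γ ν)) →
      IsBetween (domSpace φ μ) (ranSpace φ μ) (γ μ) ∧ ‖γ μ‖ ≤ 1

end PositiveDefinite

end

end FreeGroupPD

namespace FreeGroupPD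

set_option linter.unusedSectionVars false

/-! ### Common beginnings of words -/

/-! The classes are well ordered, and a positive definite function is built one class at a time.
Passing from the classes before `μ` to `μ` adds one unknown value at `s_μ⁻¹`; the value at `s_μ` is
its adjoint. If `t` and `u` are joined to both `e` and `s_μ` in the graph of the classes before `μ`,
then `t` and `u` are joined (`inv_mul_mem_below`). This chordality statement is the combinatorial
core and rests on the lexicographic order. It makes `C_μ` a clique whose only edge of class `μ` is
the one between `e` and `s_μ`. Every clique of `Γ_μ` with an edge of class `μ` can be translated
into `C_μ`, so positive definiteness on `Σ_μ` amounts to positive definiteness before `μ` and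
positivity of the single matrix on `C_μ` (`posDefOn_upTo`), in which one entry and its adjoint are
missing.

Such a matrix is completed geometrically. The spaces of `C_μ ∖ {s_μ}` and `C_μ ∖ {e}` are known and
share the space of `C_μ ∖ {e, s_μ}`. The compression `Γ` of the first into the second is the
identity on the shared part and a map `g : 𝐃 → 𝐑` on its complement (`transfer`). All entries of `Γ`
except the missing one are independent of `g`, so `g` and the missing entry determine each other
(`isParameter_iff`). If `g` is a contraction, so is `Γ`, and the vectors `(Γ ω_e, (1 - Γ*Γ)^{1/2}
ω_e)` and `(ω_t, 0)`, `t ≠ e`, realize the completed matrix (`exists_extension`). Conversely a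
compression of one subspace into another is a contraction (`exists_isParameter`).

Every positivity condition involves finitely many group elements, so the successive extensions,
which agree by uniqueness, glue to one function (`exists_glue`). -/

theorem exists_first_difference {α : Type*} {x y : List α} (hl : x.length = y.length)
    (hne : x ≠ y) : ∃ (p x' y' : List α) (a b : α),
      x = p ++ a :: x' ∧ y = p ++ b :: y' ∧ a ≠ b := by
  induction x generalizing y with
  | nil => cases y <;> simp_all
  | cons a x ih =>
    cases y with
    | nil => simp at hl
    | cons b y =>
      by_cases hab : a = b
      · subst hab
        obtain ⟨p, x', y', c, d, rfl, rfl, hcd⟩ := ih (by simpa using hl) (by simpa using hne)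
        exact ⟨a :: p, x', y', c, d, by simp, by simp, hcd⟩
      · exact ⟨[], x, y, a, b, rfl, rfl, hab⟩

theorem exists_common_prefix {α : Type*} (x y : List α) :
    ∃ p a b : List α, x = p ++ a ∧ y = p ++ b ∧ ∀ u ∈ a.head?, ∀ v ∈ b.head?, u ≠ v := by
  classical
  induction x generalizing y with
  | nil => exact ⟨[], [], y, by simp⟩
  | cons c x ih =>
    cases y with
    | nil => exact ⟨[], c :: x, [], by simp⟩
    | cons d y =>
      by_cases hcd : c = d
      · subst hcd
        obtain ⟨p, a, b, rfl, rfl, h⟩ := ih y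
        exact ⟨c :: p, a, b, by simp, by simp, h⟩
      · exact ⟨[], c :: x, d :: y, by simp, by simp, by simpa using hcd⟩

section Words

variable {α : Type*} [DecidableEq α]

theorem isReduced_invRev {w : List (α × Bool)} (h : FreeGroup.IsReduced w) :
    FreeGroup.IsReduced (FreeGroup.invRev w) := by
  rw [FreeGroup.isReduced_iff_reduce_eq] at h ⊢
  rw [FreeGroup.reduce_invRev, h]

/-- Cancellation at the junction would force the first letters of `a` and `b` to coincide. -/
theorem isReduced_invRev_append {a b : List (α × Bool)} (ha : FreeGroup.IsReduced a)
    (hb : FreeGroup.IsReduced b) (h : ∀ u ∈ a.head?, ∀ v ∈ b.head?, u ≠ v) :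
    FreeGroup.IsReduced (FreeGroup.invRev a ++ b) := by
  refine List.isChain_append.mpr ⟨isReduced_invRev ha, hb, fun x hx y hy hxy => ?_⟩
  cases a with
  | nil => simp at hx
  | cons u a =>
    rw [FreeGroup.invRev_cons] at hx
    simp only [FreeGroup.invRev, List.map_cons, List.map_nil, List.reverse_cons, List.reverse_nil,
      List.nil_append, List.getLast?_append, List.getLast?_singleton, Option.some_or,
      Option.mem_def, Option.some.injEq] at hx
    subst hx
    have := h u (by simp) y hy
    by_contra hne
    refine this (Prod.ext hxy ?_)
    revert hne
    cases u.2 <;> cases y.2 <;> simp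

/-- The words of `x` and `y` and the word of `x⁻¹ y`, cut at the branch point of the paths from
`1` to `x` and `y` in the Cayley tree. -/
theorem exists_branch (x y : FreeGroup α) : ∃ p a b : List (α × Bool),
    x.toWord = p ++ a ∧ y.toWord = p ++ b ∧ (x⁻¹ * y).toWord = FreeGroup.invRev a ++ b := by
  obtain ⟨p, a, b, hx, hy, h⟩ := exists_common_prefix x.toWord y.toWord
  refine ⟨p, a, b, hx, hy, ?_⟩
  have ha : FreeGroup.IsReduced a :=
    FreeGroup.isReduced_toWord.infix (hx ▸ (List.suffix_append p a).isInfix)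
  have hb : FreeGroup.IsReduced b :=
    FreeGroup.isReduced_toWord.infix (hy ▸ (List.suffix_append p b).isInfix)
  have hmk : x⁻¹ * y = FreeGroup.mk (FreeGroup.invRev a ++ b) := by
    rw [← FreeGroup.mk_toWord (x := x), ← FreeGroup.mk_toWord (x := y), hx, hy,
      ← FreeGroup.mul_mk, ← FreeGroup.mul_mk, ← FreeGroup.mul_mk, ← FreeGroup.inv_mk]
    group
  rw [hmk, FreeGroup.toWord_mk, (isReduced_invRev_append ha hb h).reduce_eq]

/-- A common beginning of `s` and `s⁻¹` has less than half of the length of `s`. -/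
theorem two_mul_length_lt_norm {s : FreeGroup α} (hs : s ≠ 1) {p a b : List (α × Bool)}
    (h : s.toWord = p ++ a) (h' : s⁻¹.toWord = p ++ b) : 2 * p.length < s.norm := by
  by_contra! hlt
  have hn : s.norm = p.length + a.length := by rw [FreeGroup.norm, h, List.length_append]
  rw [FreeGroup.toWord_inv, h, FreeGroup.invRev_append] at h'
  -- If `p` covers half of `s`, then `p = a⁻¹ d`. Hence `s = a⁻¹ d a`, and comparison with the word
  -- of `s⁻¹` gives `d⁻¹ = d`. The free group is torsion-free, so `d = 1` and `s = 1`.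
  have hpre : FreeGroup.invRev a <+: p :=
    List.prefix_of_prefix_length_le ⟨_, h'⟩ ⟨b, rfl⟩ (by simp only [FreeGroup.invRev_length]; omega)
  obtain ⟨d, hd⟩ := hpre
  have hinv : FreeGroup.invRev d = d := by
    rw [← hd, FreeGroup.invRev_append, FreeGroup.invRev_invRev, List.append_assoc]
      at h'
    exact (List.append_inj (List.append_cancel_left h') (by simp)).1
  have hsq : FreeGroup.mk d * FreeGroup.mk d = 1 := by
    rw [mul_eq_one_iff_eq_inv, FreeGroup.inv_mk, hinv]
  have hd1 : FreeGroup.mk d = 1 := by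
    rw [← pow_two] at hsq
    exact (pow_eq_one_iff_left two_ne_zero).mp hsq
  apply hs
  rw [← FreeGroup.mk_toWord (x := s), h, ← hd, ← FreeGroup.mul_mk, ← FreeGroup.mul_mk, hd1,
    ← FreeGroup.inv_mk]
  group

/-- What cancels in `s * s` is the common beginning of `s⁻¹` and `s`, which is shorter than half of
`s`. -/
theorem norm_lt_norm_mul_self {s : FreeGroup α} (hs : s ≠ 1) : s.norm < (s * s).norm := by
  obtain ⟨p, a, b, ha, hb, hab⟩ := exists_branch s⁻¹ s
  have h := two_mul_length_lt_norm hs hb ha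
  rw [inv_inv] at hab
  have h1 : s⁻¹.norm = p.length + a.length := by rw [FreeGroup.norm, ha, List.length_append]
  have h2 : s.norm = p.length + b.length := by rw [FreeGroup.norm, hb, List.length_append]
  have h3 : (s * s).norm = a.length + b.length := by
    rw [FreeGroup.norm, hab, List.length_append, FreeGroup.invRev_length]
  rw [FreeGroup.norm_inv_eq] at h1
  omega

end Words

/-! ### The chordality of the graphs -/

section Order

variable {m : ℕ} [LinearOrder (FG m)]

theorem inv_mem_below {ν : Cls m} {t : FG m} : t⁻¹ ∈ below ν ↔ t ∈ below ν := by
  change min t⁻¹ t⁻¹⁻¹ < ν.1 ↔ min t t⁻¹ < ν.1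
  rw [inv_inv, min_comm]

theorem inv_mem_upTo {ν : Cls m} {t : FG m} : t⁻¹ ∈ upTo ν ↔ t ∈ upTo ν := by
  change min t⁻¹ t⁻¹⁻¹ ≤ ν.1 ↔ min t t⁻¹ ≤ ν.1
  rw [inv_inv, min_comm]

theorem inv_mul_mem_below_comm {ν : Cls m} {s t : FG m} :
    s⁻¹ * t ∈ below ν ↔ t⁻¹ * s ∈ below ν := by
  rw [← inv_mem_below, mul_inv_rev, inv_inv]

theorem mem_upTo_iff {ν : Cls m} {t : FG m} : t ∈ upTo ν ↔ t ∈ below ν ∨ t = ν.1 ∨ t = ν.1⁻¹ := by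
  have h := ν.2.2
  change min t t⁻¹ ≤ ν.1 ↔ min t t⁻¹ < ν.1 ∨ _
  constructor
  · intro h'
    refine h'.lt_or_eq.imp_right fun h' => ?_
    rcases min_choice t t⁻¹ with e | e <;> rw [e] at h'
    · exact Or.inl h'
    · exact Or.inr (by rw [← h', inv_inv])
  · rintro (h' | rfl | rfl)
    · exact h'.le
    · exact min_le_left _ _
    · rw [inv_inv]; exact min_le_right _ _

theorem below_subset_upTo (ν : Cls m) : below ν ⊆ upTo ν := fun _ h => mem_upTo_iff.mpr (Or.inl h)

theorem rep_mem_upTo (ν : Cls m) : ν.1 ∈ upTo ν := mem_upTo_iff.mpr (Or.inr (Or.inl rfl))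

theorem rep_notMem_below (ν : Cls m) : ν.1 ∉ below ν := fun h =>
  (min_lt_iff.mp h).elim (lt_irrefl _) ν.2.2.not_gt

theorem isClique_pair (ν : Cls m) : (graph ν).IsClique {1, ν.1} := by
  rw [SimpleGraph.isClique_pair]
  intro h
  refine ⟨h, ?_⟩
  rw [inv_one, one_mul]
  exact rep_mem_upTo ν

theorem exists_rep (t : FG m) (ht : t ≠ 1) : ∃ ν : Cls m, t = ν.1 ∨ t = ν.1⁻¹ := by
  rcases le_total t t⁻¹ with h | h
  · exact ⟨⟨t, ht, h⟩, Or.inl rfl⟩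
  · exact ⟨⟨t⁻¹, inv_ne_one.mpr ht, by rwa [inv_inv]⟩, Or.inr (inv_inv t).symm⟩

variable [IsLexicographic m]

theorem lt_of_norm_lt {s t : FG m} (h : s.norm < t.norm) : s < t :=
  lt_of_le_of_ne (IsLexicographic.le_of_norm_lt s t h) (by rintro rfl; exact lt_irrefl _ h)

theorem norm_le_of_le {s t : FG m} (h : s ≤ t) : s.norm ≤ t.norm := by
  by_contra! hn
  exact (lt_of_norm_lt hn).not_ge h

theorem lt_of_letter_lt {s t : FG m} {p v w : List (Fin m × Bool)} {a b : Fin m × Bool}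
    (hn : s.norm = t.norm) (hs : s.toWord = p ++ a :: v) (ht : t.toWord = p ++ b :: w)
    (hab : a ≠ b) (hle : FreeGroup.mk [a] ≤ FreeGroup.mk [b]) : s < t := by
  refine lt_of_le_of_ne (IsLexicographic.le_of_letter_le s t p v w a b hn hs ht hab hle) ?_
  rintro rfl
  rw [hs] at ht
  simp at ht
  exact hab ht.1

/-- A word between two words of the same length with a common beginning has this beginning. -/
theorem exists_prefix_of_between {x y z : FG m} (hxy : x < y) (hyz : y ≤ z)
    (hx : x.norm = y.norm) (hz : y.norm = z.norm) {p a b : List (Fin m × Bool)}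
    (hxp : x.toWord = p ++ a) (hzp : z.toWord = p ++ b) : ∃ c, y.toWord = p ++ c := by
  by_contra! hc
  have hle : p.length ≤ y.toWord.length := by
    change p.length ≤ y.norm
    rw [← hx, FreeGroup.norm, hxp, List.length_append]
    omega
  have hne : y.toWord.take p.length ≠ p := fun h =>
    hc (y.toWord.drop p.length) (by
      conv_lhs => rw [← List.take_append_drop p.length y.toWord, h])
  obtain ⟨q, y', p', c, d, hy', hp', hcd⟩ :=
    exists_first_difference (by rw [List.length_take]; omega) hne
  have hy : y.toWord = q ++ c :: (y' ++ y.toWord.drop p.length) := by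
    conv_lhs => rw [← List.take_append_drop p.length y.toWord, hy']
    simp
  rw [hp', List.append_assoc, List.cons_append] at hxp hzp
  -- Both `x` and `z` have the letter `d` at this place, so comparing `c` with `d` puts `y` below
  -- both or above both.
  rcases le_total (FreeGroup.mk [c] : FG m) (FreeGroup.mk [d]) with h | h
  · exact (lt_of_letter_lt hx.symm hy hxp hcd h).not_gt hxy
  · exact (lt_of_letter_lt hz.symm hzp hy hcd.symm h).not_ge hyz

theorem one_mem_below (ν : Cls m) : (1 : FG m) ∈ below ν := by
  change min 1 1⁻¹ < ν.1
  rw [inv_one, min_self]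
  refine lt_of_norm_lt ?_
  rw [FreeGroup.norm_one, Nat.pos_iff_ne_zero, Ne, FreeGroup.norm_eq_zero]
  exact ν.2.1

theorem norm_le_of_mem_below {ν : Cls m} {t : FG m} (h : t ∈ below ν) : t.norm ≤ ν.1.norm := by
  rcases min_lt_iff.mp h with h | h
  · exact norm_le_of_le h.le
  · simpa using norm_le_of_le h.le

theorem mem_below_of_norm_lt {ν : Cls m} {t : FG m} (h : t.norm < ν.1.norm) : t ∈ below ν :=
  min_lt_iff.mpr (Or.inl (lt_of_norm_lt h))

/-- Here `t` leaves the path to `s = s_ν` after `p`, and `u` still begins with `p`. The length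
bounds on `t⁻¹ s` and `u` give `|t⁻¹ u| ≤ |s|`. In the case of equality nothing cancels, `|b| =
|p|`, and the order of `t⁻¹ u` relative to `s` is decided by the first letter in which `b⁻¹` differs
from `p`. -/
theorem inv_mul_mem_below_of_branch {ν : Cls m} {t u : FG m} (ht1 : t ≠ 1)
    (ht : t ∈ below ν) (hu : u ∈ below ν) (hst : t⁻¹ * ν.1 ∈ below ν)
    {p a b q c : List (Fin m × Bool)}
    (hs : ν.1.toWord = p ++ a) (htw : t.toWord = p ++ b)
    (htsw : (t⁻¹ * ν.1).toWord = FreeGroup.invRev b ++ a)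
    (huw : u.toWord = p ++ q ++ c) : t⁻¹ * u ∈ below ν := by
  have hns : ν.1.norm = p.length + a.length := by rw [FreeGroup.norm, hs, List.length_append]
  have hnt : t.norm = p.length + b.length := by rw [FreeGroup.norm, htw, List.length_append]
  have hnu : u.norm = p.length + q.length + c.length := by
    rw [FreeGroup.norm, huw, List.length_append, List.length_append]
  have hnts : (t⁻¹ * ν.1).norm = b.length + a.length := by
    rw [FreeGroup.norm, htsw, List.length_append, FreeGroup.invRev_length]
  have h1 := norm_le_of_mem_below ht
  have h2 := norm_le_of_mem_below hu
  have h3 := norm_le_of_mem_below hst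
  have hmk : t⁻¹ * u = FreeGroup.mk (FreeGroup.invRev b ++ (q ++ c)) := by
    rw [← FreeGroup.mk_toWord (x := t), ← FreeGroup.mk_toWord (x := u), htw, huw,
      List.append_assoc, ← FreeGroup.mul_mk, ← FreeGroup.mul_mk, ← FreeGroup.mul_mk (L₂ := q ++ c),
      ← FreeGroup.inv_mk]
    group
  have hlen : (FreeGroup.invRev b ++ (q ++ c)).length = b.length + q.length + c.length := by
    simp [add_assoc]
  have hle : (t⁻¹ * u).norm ≤ b.length + q.length + c.length := by
    rw [hmk, ← hlen]
    exact FreeGroup.norm_mk_le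
  rcases lt_or_ge (t⁻¹ * u).norm ν.1.norm with hlt | hge
  · exact mem_below_of_norm_lt hlt
  have htuw : (t⁻¹ * u).toWord = FreeGroup.invRev b ++ (q ++ c) := by
    have hsub : List.Sublist (t⁻¹ * u).toWord (FreeGroup.invRev b ++ (q ++ c)) := by
      rw [hmk, FreeGroup.toWord_mk]
      exact FreeGroup.Red.sublist FreeGroup.reduce.red
    refine hsub.eq_of_length_le ?_
    rw [hlen]
    change _ ≤ (t⁻¹ * u).norm
    omega
  have hbp : p.length = b.length := by omega
  -- If `p = b⁻¹`, then `t = p b` would be trivial.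
  have hne : p ≠ FreeGroup.invRev b := by
    rintro rfl
    apply ht1
    rw [← FreeGroup.mk_toWord (x := t), htw, ← FreeGroup.mul_mk, ← FreeGroup.inv_mk]
    group
  obtain ⟨r, p', b', x, y, hp', hb', hxy⟩ :=
    exists_first_difference (by rw [FreeGroup.invRev_length, hbp]) hne
  rw [hb', List.append_assoc, List.cons_append] at htuw htsw
  have hs' := hs
  rw [hp', List.append_assoc, List.cons_append] at hs'
  rcases le_total (FreeGroup.mk [y] : FG m) (FreeGroup.mk [x]) with h | h
  · exact min_lt_iff.mpr (Or.inl (lt_of_letter_lt (by omega) htuw hs' hxy.symm h))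
  -- Now `s < t⁻¹ s`, so `t⁻¹ s` can precede `ν` only through its inverse: `(t⁻¹ s)⁻¹ < s ≤ s⁻¹`.
  -- The outer two words begin with `a⁻¹`, hence so does `s`. Thus `2|a| < |s| = |p| + |a|`, whereas
  -- `|t| ≤ |s|` gives `|p| = |b| ≤ |a|`.
  · exfalso
    have hlt : ν.1 < t⁻¹ * ν.1 := lt_of_letter_lt (by omega) hs' htsw hxy h
    have hlt' : (t⁻¹ * ν.1)⁻¹ < ν.1 := (min_lt_iff.mp hst).resolve_left hlt.not_gt
    have hsinv : ν.1⁻¹.toWord = FreeGroup.invRev a ++ FreeGroup.invRev p := by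
      rw [FreeGroup.toWord_inv, hs, FreeGroup.invRev_append]
    have htsinv : (t⁻¹ * ν.1)⁻¹.toWord = FreeGroup.invRev a ++ b := by
      rw [FreeGroup.toWord_inv, htsw, ← List.cons_append, ← List.append_assoc, ← hb',
        FreeGroup.invRev_append, FreeGroup.invRev_invRev]
    obtain ⟨e, he⟩ := exists_prefix_of_between hlt' ν.2.2 (by rw [FreeGroup.norm_inv_eq]; omega)
      FreeGroup.norm_inv_eq.symm htsinv hsinv
    have := two_mul_length_lt_norm ν.2.1 he hsinv
    rw [FreeGroup.invRev_length] at this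
    omega

/-- In the graph of the classes before `ν`, a cycle of length four through `1` and `s_ν`, which
are not adjacent, has its other diagonal as a chord. -/
theorem inv_mul_mem_below {ν : Cls m} {t u : FG m}
    (ht : t ∈ below ν) (hu : u ∈ below ν) (hst : t⁻¹ * ν.1 ∈ below ν)
    (hsu : u⁻¹ * ν.1 ∈ below ν) : t⁻¹ * u ∈ below ν := by
  by_cases ht1 : t = 1
  · simpa [ht1] using hu
  by_cases hu1 : u = 1
  · simpa [hu1, inv_mem_below] using ht
  obtain ⟨p, b, a, htw, hsw, htsw⟩ := exists_branch t ν.1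
  obtain ⟨q, d, c, huw, hsw', husw⟩ := exists_branch u ν.1
  -- The situation is symmetric in `t` and `u`; the one that leaves the path to `s_ν` first plays
  -- the role of `t`.
  rcases le_total p.length q.length with h | h
  · obtain ⟨r, rfl⟩ := List.prefix_of_prefix_length_le ⟨a, hsw.symm⟩ ⟨c, hsw'.symm⟩ h
    exact inv_mul_mem_below_of_branch ht1 ht hu hst hsw htw htsw huw
  · obtain ⟨r, rfl⟩ := List.prefix_of_prefix_length_le ⟨c, hsw'.symm⟩ ⟨a, hsw.symm⟩ h
    exact inv_mul_mem_below_comm.mp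
      (inv_mul_mem_below_of_branch hu1 hu ht hsu hsw' huw husw htw)

/-! ### The clique through `e` and `s_ν` -/

theorem mem_clique {ν : Cls m} {t : FG m} : t ∈ clique ν ↔ t ∈ cliqueSet ν :=
  Set.Finite.mem_toFinset _

theorem one_mem_clique (ν : Cls m) : (1 : FG m) ∈ clique ν :=
  mem_clique.mpr ⟨_, ⟨isClique_pair ν, by simp, by simp⟩, by simp⟩

theorem rep_mem_clique (ν : Cls m) : ν.1 ∈ clique ν :=
  mem_clique.mpr ⟨_, ⟨isClique_pair ν, by simp, by simp⟩, by simp⟩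

theorem one_mem_cliqueD (ν : Cls m) : (1 : FG m) ∈ cliqueD ν :=
  Finset.mem_erase.mpr ⟨ν.2.1.symm, one_mem_clique ν⟩

theorem rep_mem_cliqueR (ν : Cls m) : ν.1 ∈ cliqueR ν :=
  Finset.mem_erase.mpr ⟨ν.2.1, rep_mem_clique ν⟩

/-- This keeps `s_ν⁻¹` and `s_ν²` out of `C_ν`: each would give a second edge of class `ν` at `e` or
`s_ν`, but has quotient `s_ν²`, up to inversion, with the other end. -/
theorem rep_mul_rep_notMem_upTo (ν : Cls m) : ν.1 * ν.1 ∉ upTo ν := by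
  have h := norm_lt_norm_mul_self ν.2.1
  intro h'
  rcases min_le_iff.mp h' with h' | h'
  · exact (norm_le_of_le h').not_gt h
  · have := norm_le_of_le h'
    rw [FreeGroup.norm_inv_eq] at this
    exact this.not_gt h

theorem mem_below_of_mem_clique {ν : Cls m} {t : FG m} (ht : t ∈ clique ν) (hts : t ≠ ν.1) :
    t ∈ below ν := by
  obtain ⟨K, ⟨hK, h1, hs⟩, htK⟩ := mem_clique.mp ht
  by_cases ht1 : t = 1
  · exact ht1 ▸ one_mem_below ν
  have h : t ∈ upTo ν := by simpa using (hK h1 htK (Ne.symm ht1)).2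
  rcases mem_upTo_iff.mp h with h | h | h
  · exact h
  · exact absurd h hts
  · refine absurd ?_ (rep_mul_rep_notMem_upTo ν)
    have := (hK htK hs hts).2
    rwa [h, inv_inv] at this

theorem inv_mul_rep_mem_below_of_mem_clique {ν : Cls m} {t : FG m} (ht : t ∈ clique ν)
    (ht1 : t ≠ 1) : t⁻¹ * ν.1 ∈ below ν := by
  obtain ⟨K, ⟨hK, h1, hs⟩, htK⟩ := mem_clique.mp ht
  by_cases hts : t = ν.1
  · rw [hts, inv_mul_cancel]
    exact one_mem_below ν
  rcases mem_upTo_iff.mp (hK htK hs hts).2 with h | h | h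
  · exact h
  · exact absurd (by simpa using h) ht1
  · refine absurd ?_ (rep_mul_rep_notMem_upTo ν)
    have ht' : t = ν.1 * ν.1 := by
      calc t = ν.1 * (t⁻¹ * ν.1)⁻¹ := by group
        _ = ν.1 * ν.1 := by rw [h, inv_inv]
    rw [← ht']
    simpa using (hK h1 htK (Ne.symm ht1)).2

/-- `C_ν` is defined as a union of cliques, so `t` and `u` need not come from the same one. Away
from `e` and `s_ν` they are common neighbours of both through earlier classes, and chordality joins
them. Hence only the pair `e`, `s_ν` can have a quotient of class `ν`. -/
theorem inv_mul_mem_below_of_mem_clique {ν : Cls m} {t u : FG m} (ht : t ∈ clique ν)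
    (hu : u ∈ clique ν) (h : t ≠ 1 ∧ u ≠ 1 ∨ t ≠ ν.1 ∧ u ≠ ν.1) : t⁻¹ * u ∈ below ν := by
  rcases h with ⟨ht1, hu1⟩ | ⟨hts, hus⟩
  · by_cases hts : t = ν.1
    · rw [hts, inv_mul_mem_below_comm]
      exact inv_mul_rep_mem_below_of_mem_clique hu hu1
    by_cases hus : u = ν.1
    · rw [hus]
      exact inv_mul_rep_mem_below_of_mem_clique ht ht1
    exact inv_mul_mem_below (mem_below_of_mem_clique ht hts) (mem_below_of_mem_clique hu hus)
      (inv_mul_rep_mem_below_of_mem_clique ht ht1) (inv_mul_rep_mem_below_of_mem_clique hu hu1)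
  · by_cases ht1 : t = 1
    · rw [ht1, inv_one, one_mul]
      exact mem_below_of_mem_clique hu hus
    by_cases hu1 : u = 1
    · rw [hu1, mul_one, inv_mem_below]
      exact mem_below_of_mem_clique ht hts
    exact inv_mul_mem_below (mem_below_of_mem_clique ht hts) (mem_below_of_mem_clique hu hus)
      (inv_mul_rep_mem_below_of_mem_clique ht ht1) (inv_mul_rep_mem_below_of_mem_clique hu hu1)

theorem inv_mul_mem_below_of_mem_cliqueD {ν : Cls m} {t u : FG m} (ht : t ∈ cliqueD ν)
    (hu : u ∈ cliqueD ν) : t⁻¹ * u ∈ below ν :=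
  inv_mul_mem_below_of_mem_clique (Finset.mem_of_mem_erase ht) (Finset.mem_of_mem_erase hu)
    (Or.inr ⟨Finset.ne_of_mem_erase ht, Finset.ne_of_mem_erase hu⟩)

theorem inv_mul_mem_below_of_mem_cliqueR {ν : Cls m} {t u : FG m} (ht : t ∈ cliqueR ν)
    (hu : u ∈ cliqueR ν) : t⁻¹ * u ∈ below ν :=
  inv_mul_mem_below_of_mem_clique (Finset.mem_of_mem_erase ht) (Finset.mem_of_mem_erase hu)
    (Or.inl ⟨Finset.ne_of_mem_erase ht, Finset.ne_of_mem_erase hu⟩)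

theorem inv_mul_mem_upTo_of_mem_clique {ν : Cls m} {t u : FG m} (ht : t ∈ clique ν)
    (hu : u ∈ clique ν) : t⁻¹ * u ∈ upTo ν := by
  by_cases h : t ≠ 1 ∧ u ≠ 1 ∨ t ≠ ν.1 ∧ u ≠ ν.1
  · exact below_subset_upTo ν (inv_mul_mem_below_of_mem_clique ht hu h)
  · rw [mem_upTo_iff]
    have := ν.2.1
    by_cases ht1 : t = 1
    · by_cases hus : u = ν.1
      · simp [ht1, hus]
      · exact absurd (Or.inr ⟨ht1 ▸ this.symm, hus⟩) h
    · have hu1 : u = 1 := by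
        by_contra hu1
        exact h (Or.inl ⟨ht1, hu1⟩)
      by_cases hts : t = ν.1
      · simp [hts, hu1]
      · exact absurd (Or.inr ⟨hts, hu1 ▸ this.symm⟩) h

/-- Every clique of `Γ_ν` with an edge of the class `ν` is, up to translation, contained
in `C_ν`. -/
theorem inv_mul_mem_clique {ι : Type*} {ν : Cls m} {f : ι → FG m}
    (hf : ∀ i j, (f i)⁻¹ * f j ∈ upTo ν) {i j : ι} (hij : (f i)⁻¹ * f j = ν.1) (k : ι) :
    (f i)⁻¹ * f k ∈ clique ν := by
  refine mem_clique.mpr ⟨Set.range fun k => (f i)⁻¹ * f k, ⟨?_, ⟨i, by simp⟩, ⟨j, hij⟩⟩, ⟨k, rfl⟩⟩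
  rintro _ ⟨k, rfl⟩ _ ⟨l, rfl⟩ hkl
  refine ⟨hkl, ?_⟩
  have : ((f i)⁻¹ * f k)⁻¹ * ((f i)⁻¹ * f l) = (f k)⁻¹ * f l := by group
  rw [this]
  exact hf k l

/-! ### Induction over the classes -/

/-- An initial segment consists of words of bounded length in a finite alphabet, so it is finite,
and its cardinality is a strictly monotone map to `ℕ`. -/
instance : WellFoundedLT (Cls m) := by
  have hfin : ∀ ν : Cls m, {κ : Cls m | κ ≤ ν}.Finite := fun ν => by
    have : {t : FG m | t.norm ≤ ν.1.norm}.Finite :=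
      (List.finite_length_le (Fin m × Bool) ν.1.norm).preimage
        (f := FreeGroup.toWord) FreeGroup.toWord_injective.injOn
    exact (this.preimage Subtype.val_injective.injOn).subset fun κ hκ => norm_le_of_le hκ
  refine StrictMono.wellFoundedLT (f := fun ν : Cls m => {κ : Cls m | κ ≤ ν}.ncard) ?_
  intro κ ν h
  refine Set.ncard_lt_ncard ⟨fun x hx => le_trans hx h.le, fun h' => ?_⟩ (hfin ν)
  exact (h' (le_refl ν : ν ∈ {κ : Cls m | κ ≤ ν})).not_gt h

end Order

/-! ### Block operators and Gram operators -/

section Hilbert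

variable {H : Type*} [NormedAddCommGroup H] [InnerProductSpace ℂ H] [CompleteSpace H]
variable {E : Type*} [NormedAddCommGroup E] [InnerProductSpace ℂ E] [CompleteSpace E]
variable {F : Type*} [NormedAddCommGroup F] [InnerProductSpace ℂ F] [CompleteSpace F]

theorem inner_blockOp {ι : Type*} [Fintype ι] (A : ι → ι → (H →L[ℂ] H)) (x y : DSum H ι) :
    ⟪x, blockOp A y⟫_ℂ = ∑ i, ∑ j, ⟪x i, A i j (y j)⟫_ℂ := by
  simp only [blockOp, sum_apply, inner_sum, ContinuousLinearMap.comp_apply, emb,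
    ContinuousLinearMap.adjoint_inner_right]
  rfl

theorem inner_blockOp_emb {ι : Type*} [Fintype ι] (A : ι → ι → (H →L[ℂ] H)) (i j : ι) (h k : H) :
    ⟪emb H i h, blockOp A (emb H j k)⟫_ℂ = ⟪h, A i j k⟫_ℂ := by
  classical
  have hemb : ∀ (i : ι) (h : H), emb H i h = PiLp.single 2 i h := by
    intro i h
    refine ext_inner_left ℂ fun v => ?_
    rw [emb, ContinuousLinearMap.adjoint_inner_right, PiLp.inner_apply]
    rw [Finset.sum_eq_single i]
    · simp [coord]
    · intro b _ hb
      simp [hb]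
    · simp
  rw [inner_blockOp, hemb, hemb, Finset.sum_eq_single i, Finset.sum_eq_single j]
  · simp
  · intro b _ hb
    simp [hb]
  · simp
  · intro b _ hb
    simp [hb]
  · simp

theorem inner_opSqrt {T : E →L[ℂ] E} (hT : T.IsPositive) (x y : E) :
    ⟪opSqrt T x, opSqrt T y⟫_ℂ = ⟪x, T y⟫_ℂ := by
  have h0 : (0 : E →L[ℂ] E) ≤ T := (ContinuousLinearMap.nonneg_iff_isPositive T).mpr hT
  have h1 : IsSelfAdjoint (CFC.sqrt T) := (CFC.sqrt_nonneg T).isSelfAdjoint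
  rw [opSqrt, ← ContinuousLinearMap.adjoint_inner_right, ← ContinuousLinearMap.star_eq_adjoint,
    h1.star_eq, ← mul_apply_eq_comp, CFC.sqrt_mul_sqrt_self T h0]

theorem isPositive_of_inner {T : E →L[ℂ] E} {q : E → ℝ} (hq : ∀ x, 0 ≤ q x)
    (h : ∀ x, ⟪x, T x⟫_ℂ = q x) : T.IsPositive := by
  rw [ContinuousLinearMap.isPositive_iff_complex]
  intro x
  rw [← inner_conj_symm, h, Complex.conj_ofReal]
  simpa using hq x

/-- An operator matrix that is a sum of two Gram matrices is positive. -/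
theorem isPositive_blockOp_of_gram {ι : Type*} [Fintype ι] {A : ι → ι → (H →L[ℂ] H)}
    (z : ι → (H →L[ℂ] E)) (w : ι → (H →L[ℂ] F))
    (h : ∀ i j h k, ⟪h, A i j k⟫_ℂ = ⟪z i h, z j k⟫_ℂ + ⟪w i h, w j k⟫_ℂ) :
    (blockOp A).IsPositive := by
  refine isPositive_of_inner (q := fun x => ‖∑ i, z i (x i)‖ ^ 2 + ‖∑ i, w i (x i)‖ ^ 2)
    (fun x => by positivity) fun x => ?_
  have hE := inner_self_eq_norm_sq_to_K (𝕜 := ℂ) (∑ i, z i (x i))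
  have hF := inner_self_eq_norm_sq_to_K (𝕜 := ℂ) (∑ i, w i (x i))
  simp only [Complex.coe_algebraMap] at hE hF
  rw [inner_blockOp, Complex.ofReal_add, Complex.ofReal_pow, Complex.ofReal_pow, ← hE, ← hF]
  simp only [h, Finset.sum_add_distrib, sum_inner, inner_sum]
  congr 1 <;> exact Finset.sum_comm

/-- A positive matrix is the Gram matrix of the columns of its square root, and these can be
reindexed. As `f` need not be injective, repeated points are covered. -/
theorem isPositive_blockOp_comp {ι κ : Type*} [Fintype ι] [Fintype κ]
    {A : κ → κ → (H →L[ℂ] H)} (hA : (blockOp A).IsPositive) (f : ι → κ) :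
    (blockOp fun i j => A (f i) (f j)).IsPositive := by
  have hgram : ∀ i j h k, ⟪h, A i j k⟫_ℂ =
      ⟪(opSqrt (blockOp A) ∘L emb H i) h, (opSqrt (blockOp A) ∘L emb H j) k⟫_ℂ := fun i j h k => by
    rw [ContinuousLinearMap.comp_apply, ContinuousLinearMap.comp_apply, inner_opSqrt hA,
      inner_blockOp_emb]
  exact isPositive_blockOp_of_gram (fun i => opSqrt (blockOp A) ∘L emb H (f i))
    (fun _ => (0 : H →L[ℂ] H)) fun i j h k => by simpa using hgram (f i) (f j) h k

/-- Two families of operators with the same Gram matrix are related by an isometry of the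
closed spans of their ranges. -/
theorem exists_isometry_of_gram_eq {ι : Type*} [Fintype ι] (a : ι → (H →L[ℂ] E))
    (b : ι → (H →L[ℂ] F)) (h : ∀ i j h k, ⟪a i h, a j k⟫_ℂ = ⟪b i h, b j k⟫_ℂ) :
    ∃ V : E →L[ℂ] F, (∀ i h, V (a i h) = b i h) ∧
      ∀ x ∈ (⨆ i, (a i).range).topologicalClosure, ‖V x‖ = ‖x‖ := by
  classical
  set A : (ι → H) →ₗ[ℂ] E := ∑ i, (a i : H →ₗ[ℂ] E) ∘ₗ LinearMap.proj i with hA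
  set B : (ι → H) →ₗ[ℂ] F := ∑ i, (b i : H →ₗ[ℂ] F) ∘ₗ LinearMap.proj i with hB
  have hAx : ∀ x, A x = ∑ i, a i (x i) := fun x => by simp [hA]
  have hBx : ∀ x, B x = ∑ i, b i (x i) := fun x => by simp [hB]
  have hnorm : ∀ x, ‖B x‖ = ‖A x‖ := fun x => by
    rw [← sq_eq_sq₀ (norm_nonneg _) (norm_nonneg _), ← Complex.ofReal_inj]
    push_cast
    have hE := inner_self_eq_norm_sq_to_K (𝕜 := ℂ) (A x)
    have hF := inner_self_eq_norm_sq_to_K (𝕜 := ℂ) (B x)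
    refine hF.symm.trans (Eq.trans ?_ hE)
    rw [hAx, hBx]
    simp only [sum_inner, inner_sum, h]
  set Z := (LinearMap.range A).topologicalClosure with hZ
  have hAZ : ∀ x, A x ∈ Z := fun x => Submodule.le_topologicalClosure _ ⟨x, rfl⟩
  let A' : (ι → H) →ₗ[ℂ] Z := A.codRestrict Z hAZ
  have hdense : DenseRange A' := by
    refine Subtype.dense_iff.mpr fun x hx => ?_
    rw [← Set.range_comp]
    exact hx
  -- Equal Gram matrices mean `‖B x‖ = ‖A x‖`, so `A x ↦ B x` is well defined and isometric on a
  -- dense subspace of `Z`.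
  let V₀ : Z →L[ℂ] F := B.extendOfNorm A'
  have hV₀ : ∀ x, V₀ (A' x) = B x := fun x =>
    LinearMap.extendOfNorm_eq hdense ⟨1, fun x => by rw [one_mul, hnorm]; rfl⟩ x
  have : CompleteSpace Z := (Submodule.isClosed_topologicalClosure _).completeSpace_coe
  have hA1 : ∀ i h, A (Pi.single i h) = a i h := fun i h => by
    rw [hAx, Finset.sum_eq_single i]
    · simp
    · intro j _ hj
      simp [hj]
    · simp
  have hB1 : ∀ i h, B (Pi.single i h) = b i h := fun i h => by
    rw [hBx, Finset.sum_eq_single i]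
    · simp
    · intro j _ hj
      simp [hj]
    · simp
  have hproj : ∀ x, (V₀ ∘L Z.orthogonalProjectionOnto) (A x) = B x := fun x => by
    rw [ContinuousLinearMap.comp_apply, ← hV₀]
    congr 1
    exact Submodule.orthogonalProjectionOnto_mem_subspace_eq_self (A' x)
  -- The projection onto `Z` only serves to define the operator on all of `E`.
  refine ⟨V₀ ∘L Z.orthogonalProjectionOnto, fun i h => ?_, fun x hx => ?_⟩
  · rw [← hA1, hproj, hB1]
  · have hle : ⨆ i, (a i).range ≤ LinearMap.range A := iSup_le fun i => by
      rintro _ ⟨h, rfl⟩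
      exact ⟨Pi.single i h, hA1 i h⟩
    have hx' : x ∈ closure (LinearMap.range A : Set E) := Submodule.topologicalClosure_mono hle hx
    refine closure_minimal (s := (LinearMap.range A : Set E))
      (t := {x | ‖(V₀ ∘L Z.orthogonalProjectionOnto) x‖ = ‖x‖}) ?_
      (isClosed_eq (by fun_prop) (by fun_prop)) hx'
    rintro _ ⟨y, rfl⟩
    change ‖(V₀ ∘L Z.orthogonalProjectionOnto) (A y)‖ = ‖A y‖
    rw [hproj, hnorm]

/-- An operator that preserves the norms on a subspace preserves the inner products there. -/
theorem inner_eq_of_norm_eq {V : E →L[ℂ] F} {K : Submodule ℂ E} (h : ∀ x ∈ K, ‖V x‖ = ‖x‖)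
    {x y : E} (hx : x ∈ K) (hy : y ∈ K) : ⟪V x, V y⟫_ℂ = ⟪x, y⟫_ℂ := by
  let L : K →ₗᵢ[ℂ] F := ⟨(V : E →ₗ[ℂ] F) ∘ₗ K.subtype, fun x => h x x.2⟩
  exact L.inner_map_map ⟨x, hx⟩ ⟨y, hy⟩

/-- If `⟪y, N x⟫ = 0` for generators `x` and `y` of two closed subspaces, then for all of their
elements. -/
theorem inner_eq_zero_of_generators {ι κ : Type*} {a : ι → (H →L[ℂ] E)} {b : κ → (H →L[ℂ] F)}
    {N : E →L[ℂ] F} (h : ∀ i j h k, ⟪b j h, N (a i k)⟫_ℂ = 0) {x : E} {y : F}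
    (hx : x ∈ (⨆ i, (a i).range).topologicalClosure)
    (hy : y ∈ (⨆ j, (b j).range).topologicalClosure) : ⟪y, N x⟫_ℂ = 0 := by
  set Z := (⨆ j, (b j).range).topologicalClosure
  have hle : (⨆ i, (a i).range).topologicalClosure ≤ Zᗮ.comap (N : E →ₗ[ℂ] F) := by
    refine Submodule.topologicalClosure_minimal _ (iSup_le fun i => ?_)
      ((Submodule.isClosed_orthogonal Z).preimage N.continuous)
    rintro _ ⟨k, rfl⟩
    change N (a i k) ∈ Zᗮ
    have : Zᗮ = (⨆ j, (b j).range)ᗮ := Submodule.orthogonal_closure _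
    rw [this, ← Submodule.iInf_orthogonal, Submodule.mem_iInf]
    intro j
    rw [Submodule.mem_orthogonal]
    rintro _ ⟨h', rfl⟩
    exact h i j h' k
  exact (Submodule.mem_orthogonal _ _).mp (hle hx) y hy

end Hilbert

/-! ### Realizations -/

section Realization

variable {m : ℕ} {H : Type*} [NormedAddCommGroup H] [InnerProductSpace ℂ H] [CompleteSpace H]
variable {φ ψ : FG m → (H →L[ℂ] H)} {S T : Finset (FG m)}

theorem inner_omega (hS : (kernelOp φ S).IsPositive) (s t : S) (h k : H) :
    ⟪omega φ S s h, omega φ S t k⟫_ℂ = ⟪h, φ ((s : FG m)⁻¹ * t) k⟫_ℂ := by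
  rw [omega, omega, ContinuousLinearMap.comp_apply, ContinuousLinearMap.comp_apply,
    inner_opSqrt hS, kernelOp, inner_blockOp_emb]

instance (φ : FG m → (H →L[ℂ] H)) (S T : Finset (FG m)) : CompleteSpace (spanIn φ S T) :=
  (Submodule.isClosed_topologicalClosure _).completeSpace_coe

theorem omega_mem_spanIn (t : S) (ht : (t : FG m) ∈ T) (h : H) : omega φ S t h ∈ spanIn φ S T :=
  Submodule.le_topologicalClosure _
    (Submodule.mem_iSup_of_mem (⟨t, ht⟩ : {t : S // (t : FG m) ∈ T}) ⟨h, rfl⟩)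

theorem spanIn_le_of_isClosed {M : Submodule ℂ (DSum H S)} (hM : IsClosed (M : Set (DSum H S)))
    (h : ∀ t : S, (t : FG m) ∈ T → ∀ k, omega φ S t k ∈ M) : spanIn φ S T ≤ M :=
  Submodule.topologicalClosure_minimal _ (iSup_le fun t => by
    rintro _ ⟨k, rfl⟩
    exact h t.1 t.2 k) hM

theorem spanIn_le_realization : spanIn φ S T ≤ realization φ S :=
  spanIn_le_of_isClosed (Submodule.isClosed_topologicalClosure _)
    fun t _ k => omega_mem_spanIn t t.2 k

theorem kernelOp_congr (h : ∀ s ∈ S, ∀ t ∈ S, φ (s⁻¹ * t) = ψ (s⁻¹ * t)) :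
    kernelOp φ S = kernelOp ψ S := by
  unfold kernelOp
  congr 1
  ext1 s
  ext1 t
  exact h s s.2 t t.2

theorem omega_congr (h : kernelOp φ S = kernelOp ψ S) : omega φ S = omega ψ S := by
  unfold omega
  rw [h]

theorem spanIn_congr (h : kernelOp φ S = kernelOp ψ S) (T : Finset (FG m)) :
    spanIn φ S T = spanIn ψ S T := by
  unfold spanIn
  rw [omega_congr h]

theorem isPositive_kernelOp_mono (hTS : T ⊆ S) (hS : (kernelOp φ S).IsPositive) :
    (kernelOp φ T).IsPositive :=
  isPositive_blockOp_comp hS fun t : T => (⟨t, hTS t.2⟩ : S)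

theorem exists_isEmbedding [LinearOrder (FG m)] [IsLexicographic m] (hTS : T ⊆ S)
    (hS : (kernelOp φ S).IsPositive) :
    ∃ V : DSum H T →L[ℂ] DSum H S, IsEmbedding φ hTS V := by
  have hT := isPositive_kernelOp_mono hTS hS
  obtain ⟨V, hV, hV'⟩ := exists_isometry_of_gram_eq
    (fun t : {t : T // (t : FG m) ∈ T} => omega φ T t.1)
    (fun t => omega φ S ⟨t.1, hTS t.1.2⟩)
    fun s t h k => by rw [inner_omega hT, inner_omega hS]
  exact ⟨V, fun t h => hV ⟨t, t.2⟩ h, hV'⟩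

/-! ### Positive definite functions on symmetric sets -/

/-- The points themselves need not lie in `Q`: left translation by `(f i₀)⁻¹` preserves the
quotients and turns the points into quotients, which do. -/
theorem PosDefOn.isPositive {Q : Set (FG m)} (hφ : PosDefOn Q φ) {ι : Type*} [Fintype ι]
    (f : ι → FG m) (hf : ∀ i j, (f i)⁻¹ * f j ∈ Q) :
    (blockOp fun i j => φ ((f i)⁻¹ * f j)).IsPositive := by
  rcases isEmpty_or_nonempty ι with h | ⟨⟨i₀⟩⟩
  · simp [blockOp]
  let e := Fintype.equivFin ι
  have hcalc : ∀ i j, ((f i₀)⁻¹ * f i)⁻¹ * ((f i₀)⁻¹ * f j) = (f i)⁻¹ * f j := fun i j => by group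
  have h := isPositive_blockOp_comp (hφ (Fintype.card ι) (fun i => (f i₀)⁻¹ * f (e.symm i))
    (fun i => hf _ _) fun i j => by rw [hcalc]; exact hf _ _) e
  simpa only [hcalc, Equiv.symm_apply_apply] using h

theorem PosDefOn.isPositive_kernelOp {Q : Set (FG m)} (hφ : PosDefOn Q φ)
    (hS : ∀ s ∈ S, ∀ t ∈ S, s⁻¹ * t ∈ Q) : (kernelOp φ S).IsPositive :=
  hφ.isPositive (fun s : S => (s : FG m)) fun s t => hS s s.2 t t.2

theorem PosDefOn.mono {P Q : Set (FG m)} (hφ : PosDefOn Q φ) (h : P ⊆ Q) : PosDefOn P φ :=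
  fun k s hs hs' => hφ k s (fun i => h (hs i)) fun i j => h (hs' i j)

theorem PosDefOn.congr {Q : Set (FG m)} (hφ : PosDefOn Q φ) (h : Set.EqOn φ ψ Q) :
    PosDefOn Q ψ := fun k s hs hs' => by
  have : (fun i j => φ ((s i)⁻¹ * s j)) = fun i j => ψ ((s i)⁻¹ * s j) := by
    ext1 i
    ext1 j
    exact h (hs' i j)
  rw [← this]
  exact hφ k s hs hs'

/-- This is the symmetry of the 2×2 matrix at the points `1` and `t`. -/
theorem PosDefOn.inner_inv {Q : Set (FG m)} (hφ : PosDefOn Q φ) (h1 : 1 ∈ Q) {t : FG m}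
    (ht : t ∈ Q) (ht' : t⁻¹ ∈ Q) (h k : H) : ⟪h, φ t⁻¹ k⟫_ℂ = ⟪φ t h, k⟫_ℂ := by
  have hpos := hφ.isPositive ![1, t] (by
    intro i j
    fin_cases i <;> fin_cases j <;> simpa)
  have hsym := hpos.isSymmetric (emb H 1 h) (emb H 0 k)
  change ⟪blockOp _ (emb H 1 h), emb H 0 k⟫_ℂ = ⟪emb H 1 h, blockOp _ (emb H 0 k)⟫_ℂ at hsym
  rw [← inner_conj_symm, inner_blockOp_emb, inner_blockOp_emb, inner_conj_symm] at hsym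
  simpa using hsym.symm

end Realization

/-! ### The parameter of an extension by one class -/

section Step

variable {m : ℕ} {H : Type*} [NormedAddCommGroup H] [InnerProductSpace ℂ H] [CompleteSpace H]
variable [LinearOrder (FG m)] [IsLexicographic m]
variable {φ ψ : FG m → (H →L[ℂ] H)} {μ : Cls m}

/-- The copy of `ℛ(A(φ; C_μ ∖ {e, s_μ}))` in `ℛ(A(φ; C_μ ∖ {s_μ}))`. -/
noncomputable abbrev baseD (φ : FG m → (H →L[ℂ] H)) (μ : Cls m) : Submodule ℂ (DSum H (cliqueD μ)) :=
  spanIn φ (cliqueD μ) ((cliqueD μ).erase 1)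

/-- The copy of `ℛ(A(φ; C_μ ∖ {e, s_μ}))` in `ℛ(A(φ; C_μ ∖ {e}))`. -/
noncomputable abbrev baseR (φ : FG m → (H →L[ℂ] H)) (μ : Cls m) : Submodule ℂ (DSum H (cliqueR μ)) :=
  spanIn φ (cliqueR μ) ((cliqueR μ).erase μ.1)

/-- `U` identifies the two copies `baseD` and `baseR` of `ℛ(A(φ; C_μ ∖ {e, s_μ}))`. -/
structure IsBaseIsometry (φ : FG m → (H →L[ℂ] H)) (μ : Cls m)
    (U : DSum H (cliqueD μ) →L[ℂ] DSum H (cliqueR μ)) : Prop where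
  map_omega : ∀ t (ht : t ∈ cliqueD μ) (ht' : t ∈ cliqueR μ) (h : H),
    U (omega φ (cliqueD μ) ⟨t, ht⟩ h) = omega φ (cliqueR μ) ⟨t, ht'⟩ h
  norm_map : ∀ x ∈ baseD φ μ, ‖U x‖ = ‖x‖

/-- The compression to `ℛ(A(φ; C_μ ∖ {e}))` of the embedding of `ℛ(A(φ; C_μ ∖ {s_μ}))` into
`ℛ(A(φ; C_μ))`, in terms of the parameter `g`. -/
noncomputable def transfer (φ : FG m → (H →L[ℂ] H)) (μ : Cls m)
    (U g : DSum H (cliqueD μ) →L[ℂ] DSum H (cliqueR μ)) :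
    DSum H (cliqueD μ) →L[ℂ] DSum H (cliqueR μ) :=
  U ∘L (baseD φ μ).starProjection + g

theorem exists_isBaseIsometry (hD : (kernelOp φ (cliqueD μ)).IsPositive)
    (hR : (kernelOp φ (cliqueR μ)).IsPositive) : ∃ U, IsBaseIsometry φ μ U := by
  have hmem : ∀ t : {t : cliqueD μ // (t : FG m) ∈ (cliqueD μ).erase 1}, (t : FG m) ∈ cliqueR μ :=
    fun t => Finset.mem_erase.mpr
      ⟨(Finset.mem_erase.mp t.2).1, Finset.mem_of_mem_erase t.1.2⟩
  obtain ⟨U, hU, hU'⟩ := exists_isometry_of_gram_eq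
    (fun t : {t : cliqueD μ // (t : FG m) ∈ (cliqueD μ).erase 1} => omega φ (cliqueD μ) t.1)
    (fun t => omega φ (cliqueR μ) ⟨t.1, hmem t⟩)
    fun s t h k => by rw [inner_omega hD, inner_omega hR]
  exact ⟨U, fun t ht ht' h =>
    hU ⟨⟨t, ht⟩, Finset.mem_erase.mpr ⟨Finset.ne_of_mem_erase ht', ht⟩⟩ h, hU'⟩

theorem IsBaseIsometry.map_mem {U : DSum H (cliqueD μ) →L[ℂ] DSum H (cliqueR μ)}
    (hU : IsBaseIsometry φ μ U) {x : DSum H (cliqueD μ)} (hx : x ∈ baseD φ μ) :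
    U x ∈ baseR φ μ := by
  have hle : baseD φ μ ≤ (baseR φ μ).comap (U : DSum H (cliqueD μ) →ₗ[ℂ] DSum H (cliqueR μ)) := by
    refine spanIn_le_of_isClosed
      ((Submodule.isClosed_topologicalClosure _).preimage U.continuous) fun t ht k => ?_
    have ht' : (t : FG m) ∈ cliqueR μ :=
      Finset.mem_erase.mpr ⟨(Finset.mem_erase.mp ht).1, Finset.mem_of_mem_erase t.2⟩
    change U (omega φ (cliqueD μ) t k) ∈ baseR φ μ
    rw [hU.map_omega t t.2 ht' k]
    exact omega_mem_spanIn (S := cliqueR μ) ⟨t, ht'⟩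
      (Finset.mem_erase.mpr ⟨Finset.ne_of_mem_erase t.2, ht'⟩) k
  exact hle hx

variable {U g : DSum H (cliqueD μ) →L[ℂ] DSum H (cliqueR μ)}

theorem apply_eq_zero_of_mem_baseD (hg : IsBetween (domSpace φ μ) (ranSpace φ μ) g)
    {x : DSum H (cliqueD μ)} (hx : x ∈ baseD φ μ) : g x = 0 :=
  hg.1 x <| (Submodule.mem_orthogonal _ _).mpr fun _ hu =>
    Submodule.inner_left_of_mem_orthogonal hx hu.2

theorem inner_apply_eq_zero_of_mem_baseR (hg : IsBetween (domSpace φ μ) (ranSpace φ μ) g)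
    (x : DSum H (cliqueD μ)) {y : DSum H (cliqueR μ)} (hy : y ∈ baseR φ μ) : ⟪y, g x⟫_ℂ = 0 :=
  Submodule.inner_right_of_mem_orthogonal hy (hg.2 x).2

theorem transfer_apply_of_mem_domSpace {x : DSum H (cliqueD μ)} (hx : x ∈ domSpace φ μ) :
    transfer φ μ U g x = g x := by
  have : (baseD φ μ).starProjection x = 0 := by
    rw [Submodule.starProjection_apply_eq_zero_iff]
    exact hx.2
  simp [transfer, this]

/-- The operator `g` vanishes on `baseD` and its range is orthogonal to `baseR`, so `g` can
influence only the entry at `e` and `s_μ`. The other entries come from the isometry `U` and are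
values of `φ` at quotients before `μ`. -/
theorem inner_transfer (hD : (kernelOp φ (cliqueD μ)).IsPositive)
    (hR : (kernelOp φ (cliqueR μ)).IsPositive) (hU : IsBaseIsometry φ μ U)
    (hg : IsBetween (domSpace φ μ) (ranSpace φ μ) g) (t : cliqueD μ) (u : cliqueR μ)
    (htu : (t : FG m) ≠ 1 ∨ (u : FG m) ≠ μ.1) (h k : H) :
    ⟪omega φ (cliqueR μ) u h, transfer φ μ U g (omega φ (cliqueD μ) t k)⟫_ℂ =
      ⟪h, φ ((u : FG m)⁻¹ * t) k⟫_ℂ := by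
  rw [transfer, add_apply, ContinuousLinearMap.comp_apply]
  by_cases hu : (u : FG m) = μ.1
  · have ht : (t : FG m) ∈ (cliqueD μ).erase 1 :=
      Finset.mem_erase.mpr ⟨htu.resolve_right (not_not.mpr hu), t.2⟩
    have htR : (t : FG m) ∈ cliqueR μ :=
      Finset.mem_erase.mpr ⟨(Finset.mem_erase.mp ht).1, Finset.mem_of_mem_erase t.2⟩
    have hx : omega φ (cliqueD μ) t k ∈ baseD φ μ := omega_mem_spanIn t ht k
    rw [apply_eq_zero_of_mem_baseD hg hx, add_zero, Submodule.starProjection_eq_self_iff.mpr hx,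
      hU.map_omega t t.2 htR, inner_omega hR]
  · have huR : (u : FG m) ∈ (cliqueR μ).erase μ.1 := Finset.mem_erase.mpr ⟨hu, u.2⟩
    have huD : (u : FG m) ∈ cliqueD μ := Finset.mem_erase.mpr ⟨hu, Finset.mem_of_mem_erase u.2⟩
    have hu1 : (u : FG m) ∈ (cliqueD μ).erase 1 :=
      Finset.mem_erase.mpr ⟨Finset.ne_of_mem_erase u.2, huD⟩
    have hy : omega φ (cliqueD μ) ⟨u, huD⟩ h ∈ baseD φ μ :=
      omega_mem_spanIn (S := cliqueD μ) ⟨u, huD⟩ hu1 h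
    rw [inner_add_right, inner_apply_eq_zero_of_mem_baseR hg _ (omega_mem_spanIn u huR h),
      add_zero, ← hU.map_omega u huD u.2,
      inner_eq_of_norm_eq hU.norm_map hy (Submodule.starProjection_apply_mem _ _),
      ← Submodule.inner_starProjection_left_eq_right, Submodule.starProjection_eq_self_iff.mpr hy,
      inner_omega hD]

/-- The operator is an isometry on `baseD` and acts as the contraction `g` on its complement, with
orthogonal ranges, so Pythagoras applies on both sides. -/
theorem norm_transfer_apply_le (hU : IsBaseIsometry φ μ U)
    (hg : IsBetween (domSpace φ μ) (ranSpace φ μ) g) (hg1 : ‖g‖ ≤ 1) (x : DSum H (cliqueD μ)) :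
    ‖transfer φ μ U g x‖ ≤ ‖x‖ := by
  set p := (baseD φ μ).starProjection x with hp
  have hpm : p ∈ baseD φ μ := Submodule.starProjection_apply_mem _ _
  have hq : x - p ∈ (baseD φ μ)ᗮ := Submodule.sub_starProjection_mem_orthogonal x
  have hgx : g x = g (x - p) := by
    rw [map_sub, apply_eq_zero_of_mem_baseD hg hpm, sub_zero]
  have h1 : ‖U p + g x‖ * ‖U p + g x‖ = ‖U p‖ * ‖U p‖ + ‖g x‖ * ‖g x‖ :=
    norm_add_sq_eq_norm_sq_add_norm_sq_of_inner_eq_zero _ _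
      (inner_apply_eq_zero_of_mem_baseR hg x (hU.map_mem hpm))
  have h2 : ‖p + (x - p)‖ * ‖p + (x - p)‖ = ‖p‖ * ‖p‖ + ‖x - p‖ * ‖x - p‖ :=
    norm_add_sq_eq_norm_sq_add_norm_sq_of_inner_eq_zero _ _
      (Submodule.inner_right_of_mem_orthogonal hpm hq)
  rw [add_sub_cancel] at h2
  have h3 : ‖g x‖ ≤ ‖x - p‖ := by
    rw [hgx]
    exact (g.le_of_opNorm_le hg1 _).trans_eq (one_mul _)
  have h4 : transfer φ μ U g x = U p + g x := rfl
  rw [h4]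
  rw [mul_self_le_mul_self_iff (norm_nonneg _) (norm_nonneg _), h1, h2, hU.norm_map p hpm]
  gcongr

/-- The parameter `g` at `μ` and the values `φ(s_μ)`, `φ(s_μ⁻¹)` determine each other. -/
theorem isParameter_iff (hC : (kernelOp φ (clique μ)).IsPositive) (hU : IsBaseIsometry φ μ U) :
    IsParameter φ μ g ↔ IsBetween (domSpace φ μ) (ranSpace φ μ) g ∧
      ∀ h k, ⟪omega φ (cliqueR μ) ⟨μ.1, rep_mem_cliqueR μ⟩ h,
        transfer φ μ U g (omega φ (cliqueD μ) ⟨1, one_mem_cliqueD μ⟩ k)⟫_ℂ =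
          ⟪h, φ μ.1⁻¹ k⟫_ℂ := by
  have hD := isPositive_kernelOp_mono (Finset.erase_subset μ.1 _) hC
  have hR := isPositive_kernelOp_mono (Finset.erase_subset 1 _) hC
  refine and_congr_right fun hg => ?_
  have key : ∀ (V : DSum H (cliqueD μ) →L[ℂ] DSum H (clique μ))
      (W : DSum H (cliqueR μ) →L[ℂ] DSum H (clique μ)),
      IsEmbedding φ (Finset.erase_subset _ _) V → IsEmbedding φ (Finset.erase_subset _ _) W →
      ((∀ x ∈ domSpace φ μ, ∀ y ∈ ranSpace φ μ, ⟪y, g x⟫_ℂ = ⟪W y, V x⟫_ℂ) ↔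
        ∀ h k, ⟪omega φ (cliqueR μ) ⟨μ.1, rep_mem_cliqueR μ⟩ h,
          transfer φ μ U g (omega φ (cliqueD μ) ⟨1, one_mem_cliqueD μ⟩ k)⟫_ℂ =
            ⟪h, φ μ.1⁻¹ k⟫_ℂ) := by
    intro V W hV hW
    -- `N` compares the true compression `W* V` with the one made from `g`. Its form vanishes on all
    -- pairs of generators except possibly `ω_e`, `ω_{s_μ}`, and the two conditions express in two
    -- ways that it vanishes there too.
    set N : DSum H (cliqueD μ) →L[ℂ] DSum H (cliqueR μ) :=
      ContinuousLinearMap.adjoint W ∘L V - transfer φ μ U g with hN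
    have hNi : ∀ x y, ⟪y, N x⟫_ℂ = ⟪W y, V x⟫_ℂ - ⟪y, transfer φ μ U g x⟫_ℂ := fun x y => by
      rw [hN, sub_apply, inner_sub_right, ContinuousLinearMap.comp_apply,
        ContinuousLinearMap.adjoint_inner_right]
    have hVW : ∀ (t : cliqueD μ) (u : cliqueR μ) (h k : H),
        ⟪W (omega φ _ u h), V (omega φ _ t k)⟫_ℂ = ⟪h, φ ((u : FG m)⁻¹ * t) k⟫_ℂ := by
      intro t u h k
      rw [hV.1, hW.1, inner_omega hC]
    have hgen : ∀ (t : cliqueD μ) (u : cliqueR μ), (t : FG m) ≠ 1 ∨ (u : FG m) ≠ μ.1 →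
        ∀ h k, ⟪omega φ _ u h, N (omega φ _ t k)⟫_ℂ = 0 := by
      intro t u htu h k
      rw [hNi, hVW, inner_transfer hD hR hU hg t u htu, sub_self]
    have hbase1 : ∀ x ∈ baseD φ μ, ∀ y ∈ realization φ (cliqueR μ), ⟪y, N x⟫_ℂ = 0 :=
      fun x hx y hy => inner_eq_zero_of_generators
        (fun t u h k => hgen t.1 u.1 (Or.inl (Finset.ne_of_mem_erase t.2)) h k) hx hy
    have hbase2 : ∀ x ∈ realization φ (cliqueD μ), ∀ y ∈ baseR φ μ, ⟪y, N x⟫_ℂ = 0 :=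
      fun x hx y hy => inner_eq_zero_of_generators
        (fun t u h k => hgen t.1 u.1 (Or.inr (Finset.ne_of_mem_erase u.2)) h k) hx hy
    constructor
    · intro hpar h k
      set x := omega φ (cliqueD μ) ⟨1, one_mem_cliqueD μ⟩ k
      set y := omega φ (cliqueR μ) ⟨μ.1, rep_mem_cliqueR μ⟩ h
      have hx : x ∈ realization φ (cliqueD μ) := omega_mem_spanIn _ (one_mem_cliqueD μ) k
      have hy : y ∈ realization φ (cliqueR μ) := omega_mem_spanIn _ (rep_mem_cliqueR μ) h
      set x₀ := (baseD φ μ).starProjection x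
      set y₀ := (baseR φ μ).starProjection y
      have hx₀ : x₀ ∈ baseD φ μ := Submodule.starProjection_apply_mem _ _
      have hy₀ : y₀ ∈ baseR φ μ := Submodule.starProjection_apply_mem _ _
      have hx₁ : x - x₀ ∈ domSpace φ μ :=
        ⟨sub_mem hx (spanIn_le_realization hx₀), Submodule.sub_starProjection_mem_orthogonal x⟩
      have hy₁ : y - y₀ ∈ ranSpace φ μ :=
        ⟨sub_mem hy (spanIn_le_realization hy₀), Submodule.sub_starProjection_mem_orthogonal y⟩
      have h1 := hbase1 x₀ hx₀ y hy
      have h2 := hbase2 (x - x₀) hx₁.1 y₀ hy₀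
      -- On `𝐃` and `𝐑` the form of `N` is the defect in the definition of the parameter; the base
      -- components `x₀` and `y₀` contribute nothing.
      have h3 : ⟪y - y₀, N (x - x₀)⟫_ℂ = 0 := by
        rw [hNi, transfer_apply_of_mem_domSpace hx₁, hpar _ hx₁ _ hy₁, sub_self]
      have h4 : ⟪y, N x⟫_ℂ = 0 := by
        rw [inner_sub_left, h2, sub_zero, map_sub, inner_sub_right, h1, sub_zero] at h3
        exact h3
      rw [hNi, hVW, sub_eq_zero] at h4
      rw [← h4, mul_one]
    · intro hval x hx y hy
      have hall : ⟪y, N x⟫_ℂ = 0 := by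
        refine inner_eq_zero_of_generators (fun t u h k => ?_) hx.1 hy.1
        by_cases htu : (t.1 : FG m) ≠ 1 ∨ (u.1 : FG m) ≠ μ.1
        · exact hgen t.1 u.1 htu h k
        · push Not at htu
          have ht : t.1 = ⟨1, one_mem_cliqueD μ⟩ := Subtype.ext htu.1
          have hu : u.1 = ⟨μ.1, rep_mem_cliqueR μ⟩ := Subtype.ext htu.2
          rw [hNi, hVW, ht, hu, hval, mul_one, sub_self]
      rw [hNi, transfer_apply_of_mem_domSpace hx, sub_eq_zero] at hall
      exact hall.symm
  constructor
  · rintro ⟨V, W, hV, hW, hpar⟩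
    exact (key V W hV hW).mp hpar
  · intro hval
    obtain ⟨V, hV⟩ := exists_isEmbedding (Finset.erase_subset μ.1 (clique μ)) hC
    obtain ⟨W, hW⟩ := exists_isEmbedding (Finset.erase_subset 1 (clique μ)) hC
    exact ⟨V, W, hV, hW, (key V W hV hW).mpr hval⟩

end Step

/-! ### Uniqueness and existence of the extension by one class -/

section Extension

variable {m : ℕ} {H : Type*} [NormedAddCommGroup H] [InnerProductSpace ℂ H] [CompleteSpace H]
variable [LinearOrder (FG m)] [IsLexicographic m]
variable {φ ψ : FG m → (H →L[ℂ] H)} {μ : Cls m}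

theorem kernelOp_cliqueD_congr (h : Set.EqOn φ ψ (below μ)) :
    kernelOp φ (cliqueD μ) = kernelOp ψ (cliqueD μ) :=
  kernelOp_congr fun _ hs _ ht => h (inv_mul_mem_below_of_mem_cliqueD hs ht)

theorem kernelOp_cliqueR_congr (h : Set.EqOn φ ψ (below μ)) :
    kernelOp φ (cliqueR μ) = kernelOp ψ (cliqueR μ) :=
  kernelOp_congr fun _ hs _ ht => h (inv_mul_mem_below_of_mem_cliqueR hs ht)

theorem kernelOp_clique_congr (h : Set.EqOn φ ψ (upTo μ)) :
    kernelOp φ (clique μ) = kernelOp ψ (clique μ) :=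
  kernelOp_congr fun _ hs _ ht => h (inv_mul_mem_upTo_of_mem_clique hs ht)

theorem domSpace_congr (h : Set.EqOn φ ψ (below μ)) : domSpace φ μ = domSpace ψ μ := by
  unfold domSpace realization
  rw [spanIn_congr (kernelOp_cliqueD_congr h), spanIn_congr (kernelOp_cliqueD_congr h)]

theorem ranSpace_congr (h : Set.EqOn φ ψ (below μ)) : ranSpace φ μ = ranSpace ψ μ := by
  unfold ranSpace realization
  rw [spanIn_congr (kernelOp_cliqueR_congr h), spanIn_congr (kernelOp_cliqueR_congr h)]

theorem IsParameter.congr {g : DSum H (cliqueD μ) →L[ℂ] DSum H (cliqueR μ)}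
    (h : Set.EqOn φ ψ (upTo μ)) (hg : IsParameter φ μ g) : IsParameter ψ μ g := by
  have hb := h.mono (below_subset_upTo μ)
  obtain ⟨hg, V, W, hV, hW, hVW⟩ := hg
  unfold IsParameter
  rw [← domSpace_congr hb, ← ranSpace_congr hb]
  refine ⟨hg, V, W, ?_, ?_, hVW⟩
  · unfold IsEmbedding realization
    rw [← omega_congr (kernelOp_cliqueD_congr hb), ← omega_congr (kernelOp_clique_congr h),
      ← spanIn_congr (kernelOp_cliqueD_congr hb)]
    exact hV
  · unfold IsEmbedding realization
    rw [← omega_congr (kernelOp_cliqueR_congr hb), ← omega_congr (kernelOp_clique_congr h),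
      ← spanIn_congr (kernelOp_cliqueR_congr hb)]
    exact hW

theorem IsBaseIsometry.congr {U : DSum H (cliqueD μ) →L[ℂ] DSum H (cliqueR μ)}
    (h : Set.EqOn φ ψ (below μ)) (hU : IsBaseIsometry φ μ U) : IsBaseIsometry ψ μ U := by
  obtain ⟨h1, h2⟩ := hU
  rw [omega_congr (kernelOp_cliqueD_congr h), omega_congr (kernelOp_cliqueR_congr h)] at h1
  unfold baseD at h2
  rw [spanIn_congr (kernelOp_cliqueD_congr h)] at h2
  exact ⟨h1, h2⟩

theorem transfer_congr (h : Set.EqOn φ ψ (below μ))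
    (U g : DSum H (cliqueD μ) →L[ℂ] DSum H (cliqueR μ)) :
    transfer φ μ U g = transfer ψ μ U g := by
  ext1 x
  have : ∀ K L : Submodule ℂ (DSum H (cliqueD μ)), ∀ (_ : CompleteSpace K) (_ : CompleteSpace L),
      K = L → K.starProjection x = L.starProjection x := by
    rintro K _ _ _ rfl
    rfl
  rw [transfer, transfer, add_apply, add_apply, ContinuousLinearMap.comp_apply,
    ContinuousLinearMap.comp_apply, this _ _ inferInstance inferInstance
      (spanIn_congr (kernelOp_cliqueD_congr h) _)]

theorem PosDefOn.isPositive_cliqueD (hφ : PosDefOn (below μ) φ) :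
    (kernelOp φ (cliqueD μ)).IsPositive :=
  hφ.isPositive_kernelOp fun _ hs _ ht => inv_mul_mem_below_of_mem_cliqueD hs ht

theorem PosDefOn.isPositive_cliqueR (hφ : PosDefOn (below μ) φ) :
    (kernelOp φ (cliqueR μ)).IsPositive :=
  hφ.isPositive_kernelOp fun _ hs _ ht => inv_mul_mem_below_of_mem_cliqueR hs ht

theorem PosDefOn.isPositive_clique (hφ : PosDefOn (upTo μ) φ) :
    (kernelOp φ (clique μ)).IsPositive :=
  hφ.isPositive_kernelOp fun _ hs _ ht => inv_mul_mem_upTo_of_mem_clique hs ht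

theorem one_mem_upTo (μ : Cls m) : (1 : FG m) ∈ upTo μ := below_subset_upTo μ (one_mem_below μ)

/-- Positive definite functions on `Σ_μ` that agree before `μ` and have the same parameter at `μ`
are equal. -/
theorem eqOn_upTo_of_isParameter (hφ : PosDefOn (upTo μ) φ) (hψ : PosDefOn (upTo μ) ψ)
    (h : Set.EqOn φ ψ (below μ)) {g : DSum H (cliqueD μ) →L[ℂ] DSum H (cliqueR μ)}
    (hφg : IsParameter φ μ g) (hψg : IsParameter ψ μ g) : Set.EqOn φ ψ (upTo μ) := by
  have hφb := hφ.mono (below_subset_upTo μ)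
  obtain ⟨U, hU⟩ := exists_isBaseIsometry hφb.isPositive_cliqueD hφb.isPositive_cliqueR
  have h1 := ((isParameter_iff hφ.isPositive_clique hU).mp hφg).2
  have h2 := ((isParameter_iff hψ.isPositive_clique (hU.congr h)).mp hψg).2
  rw [transfer_congr h, omega_congr (kernelOp_cliqueD_congr h),
    omega_congr (kernelOp_cliqueR_congr h)] at h1
  have hinv : φ μ.1⁻¹ = ψ μ.1⁻¹ := by
    ext1 k
    exact ext_inner_left ℂ fun v => by rw [← h1, h2]
  intro t ht
  rcases mem_upTo_iff.mp ht with ht | rfl | rfl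
  · exact h ht
  · ext1 k
    refine ext_inner_right ℂ fun v => ?_
    have hm := rep_mem_upTo μ
    rw [← hφ.inner_inv (one_mem_upTo μ) hm (inv_mem_upTo.mpr hm), hinv,
      hψ.inner_inv (one_mem_upTo μ) hm (inv_mem_upTo.mpr hm)]
  · exact hinv

/-- The parameter is unique. -/
theorem IsParameter.unique {g g' : DSum H (cliqueD μ) →L[ℂ] DSum H (cliqueR μ)}
    (hg : IsParameter φ μ g) (hg' : IsParameter φ μ g') : g = g' := by
  obtain ⟨hb, V, W, hV, hW, h⟩ := hg
  obtain ⟨hb', V', W', hV', hW', h'⟩ := hg'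
  -- The embeddings are prescribed on the generators `ω_t`, hence on the realization space; their
  -- freedom outside it does not affect the parameter.
  have hVV : ∀ x ∈ domSpace φ μ, V x = V' x := fun x hx => by
    have : realization φ (cliqueD μ) ≤ LinearMap.ker
        ((V - V' : DSum H (cliqueD μ) →L[ℂ] DSum H (clique μ)) :
          DSum H (cliqueD μ) →ₗ[ℂ] DSum H (clique μ)) :=
      spanIn_le_of_isClosed (V - V').isClosed_ker fun t _ k => by
        simp [hV.1, hV'.1]
    simpa [sub_eq_zero] using this hx.1
  have hWW : ∀ y ∈ ranSpace φ μ, W y = W' y := fun x hx => by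
    have : realization φ (cliqueR μ) ≤ LinearMap.ker
        ((W - W' : DSum H (cliqueR μ) →L[ℂ] DSum H (clique μ)) :
          DSum H (cliqueR μ) →ₗ[ℂ] DSum H (clique μ)) :=
      spanIn_le_of_isClosed (W - W').isClosed_ker fun t _ k => by
        simp [hW.1, hW'.1]
    simpa [sub_eq_zero] using this hx.1
  have : CompleteSpace (domSpace φ μ) :=
    ((Submodule.isClosed_topologicalClosure _).inter
      (Submodule.isClosed_orthogonal _)).completeSpace_coe
  have hdom : ∀ x ∈ domSpace φ μ, g x = g' x := fun x hx => by
    have hself : ⟪g x - g' x, g x - g' x⟫_ℂ = 0 := by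
      have hm : g x - g' x ∈ ranSpace φ μ := sub_mem (hb.2 x) (hb'.2 x)
      conv_lhs => rw [inner_sub_right]
      rw [h x hx _ hm, h' x hx _ hm, hVV x hx, hWW _ hm, sub_self]
    rwa [inner_self_eq_zero, sub_eq_zero] at hself
  ext1 x
  have hx := Submodule.sub_starProjection_mem_orthogonal (K := domSpace φ μ) x
  have e := hb.1 _ hx
  have e' := hb'.1 _ hx
  rw [map_sub, sub_eq_zero] at e e'
  rw [e, e', hdom _ (Submodule.starProjection_apply_mem _ _)]

/-- Every function with positive operator matrix on `C_μ` has a parameter, a contraction. -/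
theorem exists_isParameter (hC : (kernelOp φ (clique μ)).IsPositive) :
    ∃ g, IsParameter φ μ g ∧ ‖g‖ ≤ 1 := by
  obtain ⟨V, hV⟩ := exists_isEmbedding (Finset.erase_subset μ.1 (clique μ)) hC
  obtain ⟨W, hW⟩ := exists_isEmbedding (Finset.erase_subset 1 (clique μ)) hC
  have : CompleteSpace (domSpace φ μ) :=
    ((Submodule.isClosed_topologicalClosure _).inter
      (Submodule.isClosed_orthogonal _)).completeSpace_coe
  have : CompleteSpace (ranSpace φ μ) :=
    ((Submodule.isClosed_topologicalClosure _).inter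
      (Submodule.isClosed_orthogonal _)).completeSpace_coe
  -- `W* V` is the compression of one embedded space into the other; the outer projections restrict
  -- it to `𝐃` and `𝐑` and extend it by zero.
  set g : DSum H (cliqueD μ) →L[ℂ] DSum H (cliqueR μ) :=
    (ranSpace φ μ).starProjection ∘L ContinuousLinearMap.adjoint W ∘L V ∘L
      (domSpace φ μ).starProjection with hg
  have hgi : ∀ x y, ⟪y, g x⟫_ℂ =
      ⟪W ((ranSpace φ μ).starProjection y), V ((domSpace φ μ).starProjection x)⟫_ℂ := by
    intro x y
    simp only [hg, ContinuousLinearMap.comp_apply]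
    rw [← Submodule.inner_starProjection_left_eq_right, ContinuousLinearMap.adjoint_inner_right]
  refine ⟨g, ⟨⟨fun x hx => ?_, fun x => Submodule.starProjection_apply_mem _ _⟩, V, W, hV, hW,
    fun x hx y hy => ?_⟩, ?_⟩
  · simp [hg, (Submodule.starProjection_apply_eq_zero_iff _).mpr hx]
  · rw [hgi, Submodule.starProjection_eq_self_iff.mpr hx,
      Submodule.starProjection_eq_self_iff.mpr hy]
  · refine g.opNorm_le_bound zero_le_one fun x => ?_
    have h1 : ‖⟪g x, g x⟫_ℂ‖ ≤ ‖g x‖ * ‖x‖ := by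
      rw [hgi]
      refine (norm_inner_le_norm _ _).trans ?_
      rw [hW.2 _ (Submodule.starProjection_apply_mem (ranSpace φ μ) _).1,
        hV.2 _ (Submodule.starProjection_apply_mem (domSpace φ μ) _).1]
      exact mul_le_mul (Submodule.norm_starProjection_apply_le _ _)
        (Submodule.norm_starProjection_apply_le _ _) (norm_nonneg _) (norm_nonneg _)
    rw [one_mul]
    rcases eq_or_ne (g x) 0 with h0 | h0
    · rw [h0, norm_zero]
      exact norm_nonneg x
    · rw [inner_self_eq_norm_sq_to_K, norm_pow, RCLike.norm_ofReal, abs_norm, pow_two] at h1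
      exact le_of_mul_le_mul_left h1 (norm_pos_iff.mpr h0)

/-- The free group has no involutions, so values at `s_μ` and `s_μ⁻¹` can be assigned separately. -/
theorem rep_ne_inv (μ : Cls m) : μ.1 ≠ μ.1⁻¹ := fun h =>
  μ.2.1 ((pow_eq_one_iff_left two_ne_zero).mp (by rw [pow_two, mul_eq_one_iff_eq_inv]; exact h))

/-- A function is positive definite on `Σ_μ` if it is positive definite on `Σ_{μ⁻}` and its
operator matrix on `C_μ` is positive. -/
theorem posDefOn_upTo (hφ : PosDefOn (below μ) φ) (hC : (kernelOp φ (clique μ)).IsPositive) :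
    PosDefOn (upTo μ) φ := by
  intro k s hs hs'
  by_cases hb : ∀ i j, (s i)⁻¹ * s j ∈ below μ
  · exact hφ.isPositive s hb
  · push Not at hb
    obtain ⟨i, j, hij⟩ := hb
    obtain ⟨i, j, hij⟩ : ∃ i j, (s i)⁻¹ * s j = μ.1 := by
      rcases mem_upTo_iff.mp (hs' i j) with h | h | h
      · exact absurd h hij
      · exact ⟨i, j, h⟩
      · exact ⟨j, i, by rw [← inv_inj, ← h, mul_inv_rev, inv_inv]⟩
    -- An edge of class `μ` is present, so translation by `(s i)⁻¹` moves all points into `C_μ`.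
    have hmem := inv_mul_mem_clique hs' hij
    have h := isPositive_blockOp_comp hC fun l => (⟨(s i)⁻¹ * s l, hmem l⟩ : clique μ)
    have hcalc : ∀ l l', ((s i)⁻¹ * s l)⁻¹ * ((s i)⁻¹ * s l') = (s l)⁻¹ * s l' :=
      fun l l' => by group
    simpa only [hcalc] using h

/-- Every contraction from `𝐃(φ)` to `𝐑(φ)` is the parameter of an extension of `φ`. -/
theorem exists_extension (hφ : PosDefOn (below μ) φ)
    {g : DSum H (cliqueD μ) →L[ℂ] DSum H (cliqueR μ)}
    (hg : IsBetween (domSpace φ μ) (ranSpace φ μ) g) (hg1 : ‖g‖ ≤ 1) :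
    ∃ ψ, Set.EqOn φ ψ (below μ) ∧ PosDefOn (upTo μ) ψ ∧ IsParameter ψ μ g := by
  have hD := hφ.isPositive_cliqueD
  have hR := hφ.isPositive_cliqueR
  obtain ⟨U, hU⟩ := exists_isBaseIsometry hD hR
  set Γ := transfer φ μ U g with hΓ
  set a := omega φ (cliqueD μ) ⟨1, one_mem_cliqueD μ⟩ with ha
  set b := omega φ (cliqueR μ) ⟨μ.1, rep_mem_cliqueR μ⟩ with hb
  -- `B` is the entry of `Γ` at `ω_{s_μ}`, `ω_e`, which has to be the new value at `s_μ⁻¹ e`.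
  set B : H →L[ℂ] H := ContinuousLinearMap.adjoint b ∘L Γ ∘L a with hB
  set ψ : FG m → (H →L[ℂ] H) := fun t =>
    if t = μ.1⁻¹ then B else if t = μ.1 then ContinuousLinearMap.adjoint B else φ t with hψ
  have hψinv : ψ μ.1⁻¹ = B := by simp [hψ]
  have hψrep : ψ μ.1 = ContinuousLinearMap.adjoint B := by simp [hψ, rep_ne_inv μ]
  have heq : Set.EqOn φ ψ (below μ) := fun t ht => by
    have h1 : t ≠ μ.1 := by
      rintro rfl
      exact rep_notMem_below μ ht
    have h2 : t ≠ μ.1⁻¹ := by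
      rintro rfl
      exact rep_notMem_below μ (inv_mem_below.mp ht)
    simp [hψ, h1, h2]
  have hadj : ∀ t ∈ upTo μ, ∀ h k, ⟪h, ψ t⁻¹ k⟫_ℂ = ⟪ψ t h, k⟫_ℂ := by
    intro t ht h k
    rcases mem_upTo_iff.mp ht with ht | rfl | rfl
    · rw [← heq ht, ← heq (inv_mem_below.mpr ht)]
      exact hφ.inner_inv (one_mem_below μ) ht (inv_mem_below.mpr ht) h k
    · rw [hψinv, hψrep, ContinuousLinearMap.adjoint_inner_left]
    · rw [inv_inv, hψinv, hψrep, ContinuousLinearMap.adjoint_inner_right]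
  have hone : ∀ i (hi : i ∈ cliqueR μ) (h k : H),
      ⟪h, ψ (i⁻¹ * 1) k⟫_ℂ = ⟪omega φ (cliqueR μ) ⟨i, hi⟩ h, Γ (a k)⟫_ℂ := by
    intro i hi h k
    by_cases his : i = μ.1
    · subst his
      rw [mul_one, hψinv, hB, ContinuousLinearMap.comp_apply,
        ContinuousLinearMap.adjoint_inner_right, ContinuousLinearMap.comp_apply]
    · have hib : i ∈ below μ := mem_below_of_mem_clique (Finset.mem_of_mem_erase hi) his
      rw [hΓ, ha, inner_transfer hD hR hU hg ⟨1, one_mem_cliqueD μ⟩ ⟨i, hi⟩ (Or.inr his),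
        heq (by rwa [mul_one, inv_mem_below])]
  have hcontr : (1 - ContinuousLinearMap.adjoint Γ ∘L Γ :
      DSum H (cliqueD μ) →L[ℂ] DSum H (cliqueD μ)).IsPositive := by
    refine isPositive_of_inner (q := fun x => ‖x‖ ^ 2 - ‖Γ x‖ ^ 2) (fun x => ?_) fun x => ?_
    · have := norm_transfer_apply_le hU hg hg1 x
      exact sub_nonneg.mpr (pow_le_pow_left₀ (norm_nonneg _) this 2)
    · rw [sub_apply, inner_sub_right, ContinuousLinearMap.comp_apply,
        ContinuousLinearMap.adjoint_inner_right, one_apply_eq_self,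
        inner_self_eq_norm_sq_to_K, inner_self_eq_norm_sq_to_K]
      simp
  have hmemR : ∀ t : clique μ, (t : FG m) ≠ 1 → (t : FG m) ∈ cliqueR μ :=
    fun t ht => Finset.mem_erase.mpr ⟨ht, t.2⟩
  have hC : (kernelOp ψ (clique μ)).IsPositive := by
    -- The new matrix is a Gram matrix: `e` is represented by `(Γ ω_e, (1 - Γ*Γ)^{1/2} ω_e)` and
    -- every other `t` by `(ω_t, 0)`. The second component restores the norm that `ω_e` loses under
    -- `Γ` and is invisible to all other entries.
    refine isPositive_blockOp_of_gram
      (fun t : clique μ => if ht : (t : FG m) = 1 then Γ ∘L a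
        else omega φ (cliqueR μ) ⟨t, hmemR t ht⟩)
      (fun t : clique μ => if (t : FG m) = 1 then
        opSqrt (1 - ContinuousLinearMap.adjoint Γ ∘L Γ) ∘L a else 0) ?_
    intro i j h k
    by_cases hi : (i : FG m) = 1 <;> by_cases hj : (j : FG m) = 1
    · simp only [hi, hj, dite_true, if_true, ContinuousLinearMap.comp_apply, inner_opSqrt hcontr]
      rw [sub_apply, inner_sub_right, ContinuousLinearMap.comp_apply,
        ContinuousLinearMap.adjoint_inner_right, one_apply_eq_self, add_sub_cancel, ha,
        inner_omega hD, heq]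
      simpa using one_mem_below μ
    · have h1 := hone j (hmemR j hj) k h
      simp only [hi, hj, dite_true, dite_false, if_true, if_false, zero_apply, inner_zero_right,
        add_zero, ContinuousLinearMap.comp_apply, inv_one, one_mul]
      rw [mul_one, hadj _ (by simpa using inv_mul_mem_upTo_of_mem_clique (one_mem_clique μ) j.2)]
        at h1
      rw [← inner_conj_symm, h1, inner_conj_symm]
    · simp only [hi, hj, dite_true, dite_false, if_true, if_false, zero_apply, inner_zero_left,
        add_zero, ContinuousLinearMap.comp_apply]
      exact hone i (hmemR i hi) h k
    · simp only [hi, hj, dite_false, if_false, zero_apply, inner_zero_left, add_zero]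
      rw [inner_omega hR, heq (inv_mul_mem_below_of_mem_cliqueR (hmemR i hi) (hmemR j hj))]
  refine ⟨ψ, heq, posDefOn_upTo (hφ.congr heq) hC, (isParameter_iff hC (hU.congr heq)).mpr ⟨?_, ?_⟩⟩
  · rwa [← domSpace_congr heq, ← ranSpace_congr heq]
  · intro h k
    rw [← transfer_congr heq, ← omega_congr (kernelOp_cliqueD_congr heq),
      ← omega_congr (kernelOp_cliqueR_congr heq), ← hΓ, ← ha, ← hb, hψinv, hB,
      ContinuousLinearMap.comp_apply, ContinuousLinearMap.adjoint_inner_right,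
      ContinuousLinearMap.comp_apply]

end Extension

/-! ### Gluing along the order of the classes -/

section Gluing

variable {m : ℕ} {H : Type*} [NormedAddCommGroup H] [InnerProductSpace ℂ H] [CompleteSpace H]
variable [LinearOrder (FG m)] [IsLexicographic m]
variable {φ ψ : FG m → (H →L[ℂ] H)} {γ : OpSeq m H}

/-- The union of `{e}` and the classes in `S`. -/
def classUnion (S : Set (Cls m)) : Set (FG m) := {t | t = 1 ∨ ∃ ν ∈ S, t = ν.1 ∨ t = ν.1⁻¹}

theorem min_eq_of_rep {ν : Cls m} {t : FG m} (h : t = ν.1 ∨ t = ν.1⁻¹) : min t t⁻¹ = ν.1 := by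
  rcases h with rfl | rfl
  · exact min_eq_left ν.2.2
  · rw [inv_inv]
    exact min_eq_right ν.2.2

/-- This form needs no predecessor of `μ` and lets the gluing treat `below μ`, for the first class
too, in the same way as the whole group. -/
theorem below_eq_classUnion (μ : Cls m) : below μ = classUnion (Set.Iio μ) := by
  ext t
  constructor
  · intro ht
    by_cases ht1 : t = 1
    · exact Or.inl ht1
    obtain ⟨ν, hν⟩ := exists_rep t ht1
    refine Or.inr ⟨ν, ?_, hν⟩
    change ν.1 < μ.1
    rw [← min_eq_of_rep hν]
    exact ht
  · rintro (rfl | ⟨ν, hνμ, hν⟩)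
    · exact one_mem_below μ
    · change min t t⁻¹ < μ.1
      rw [min_eq_of_rep hν]
      exact hνμ

theorem classUnion_univ : classUnion (Set.univ : Set (Cls m)) = Set.univ := by
  refine Set.eq_univ_of_forall fun t => ?_
  by_cases ht1 : t = 1
  · exact Or.inl ht1
  · obtain ⟨ν, hν⟩ := exists_rep t ht1
    exact Or.inr ⟨ν, trivial, hν⟩

theorem mem_upTo_of_rep {ν μ : Cls m} {t : FG m} (h : t = ν.1 ∨ t = ν.1⁻¹) :
    t ∈ upTo μ ↔ ν ≤ μ := by
  change min t t⁻¹ ≤ μ.1 ↔ _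
  rw [min_eq_of_rep h]
  rfl

theorem upTo_mono {ν μ : Cls m} (h : ν ≤ μ) : upTo ν ⊆ upTo μ := fun _ ht => le_trans ht h

theorem upTo_subset_below {ν μ : Cls m} (h : ν < μ) : upTo ν ⊆ below μ :=
  fun _ ht => lt_of_le_of_lt ht h

/-- The classes are totally ordered, so the largest one met by `P` works. The first alternative is
needed for `P ⊆ {e}`, since `S` may be empty. -/
theorem finset_subset_classUnion {S : Set (Cls m)} (P : Finset (FG m))
    (hP : ∀ t ∈ P, t ∈ classUnion S) : (∀ t ∈ P, t = 1) ∨ ∃ ν ∈ S, ∀ t ∈ P, t ∈ upTo ν := by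
  induction P using Finset.induction_on with
  | empty => exact Or.inl (by simp)
  | insert a P _ ih =>
    have ha := hP a (Finset.mem_insert_self a P)
    rcases ih fun t ht => hP t (Finset.mem_insert_of_mem ht) with h | ⟨ν, hνS, h⟩
    · rcases ha with ha | ⟨ν, hνS, hν⟩
      · exact Or.inl (Finset.forall_mem_insert _ _ _ |>.mpr ⟨ha, h⟩)
      · exact Or.inr ⟨ν, hνS, Finset.forall_mem_insert _ _ _ |>.mpr
          ⟨(mem_upTo_of_rep hν).mpr le_rfl, fun t ht => h t ht ▸ one_mem_upTo ν⟩⟩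
    · rcases ha with ha | ⟨κ, hκS, hκ⟩
      · exact Or.inr ⟨ν, hνS, Finset.forall_mem_insert _ _ _ |>.mpr ⟨ha ▸ one_mem_upTo ν, h⟩⟩
      · rcases le_total κ ν with hle | hle
        · exact Or.inr ⟨ν, hνS, Finset.forall_mem_insert _ _ _ |>.mpr
            ⟨(mem_upTo_of_rep hκ).mpr hle, h⟩⟩
        · exact Or.inr ⟨κ, hκS, Finset.forall_mem_insert _ _ _ |>.mpr
            ⟨(mem_upTo_of_rep hκ).mpr le_rfl, fun t ht => upTo_mono hle (h t ht)⟩⟩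

/-- A normalized positive definite function on `Σ_ν` is determined by its parameters. -/
theorem eqOn_of_isParameter {ν : Cls m} (hφ : PosDefOn (upTo ν) φ) (hψ : PosDefOn (upTo ν) ψ)
    (hφ1 : φ 1 = 1) (hψ1 : ψ 1 = 1) (hφγ : ∀ κ ≤ ν, IsParameter φ κ (γ κ))
    (hψγ : ∀ κ ≤ ν, IsParameter ψ κ (γ κ)) : Set.EqOn φ ψ (upTo ν) := by
  induction ν using WellFoundedLT.induction with
  | ind ν ih =>
    refine eqOn_upTo_of_isParameter hφ hψ (fun t ht => ?_) (hφγ ν le_rfl) (hψγ ν le_rfl)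
    rw [below_eq_classUnion] at ht
    rcases ht with rfl | ⟨κ, hκ, ht⟩
    · rw [hφ1, hψ1]
    · have hκ' : κ < ν := hκ
      exact ih κ hκ (hφ.mono (upTo_mono hκ'.le)) (hψ.mono (upTo_mono hκ'.le))
        (fun κ' h => hφγ κ' (h.trans hκ'.le)) (fun κ' h => hψγ κ' (h.trans hκ'.le))
        ((mem_upTo_of_rep ht).mpr le_rfl)

theorem eqOn_below_of_isParameter {μ : Cls m} (hφ : PosDefOn (below μ) φ)
    (hψ : PosDefOn (below μ) ψ) (hφ1 : φ 1 = 1) (hψ1 : ψ 1 = 1)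
    (hφγ : ∀ κ < μ, IsParameter φ κ (γ κ)) (hψγ : ∀ κ < μ, IsParameter ψ κ (γ κ)) :
    Set.EqOn φ ψ (below μ) := by
  intro t ht
  rw [below_eq_classUnion] at ht
  rcases ht with rfl | ⟨κ, hκ, ht⟩
  · rw [hφ1, hψ1]
  · exact eqOn_of_isParameter (hφ.mono (upTo_subset_below hκ)) (hψ.mono (upTo_subset_below hκ))
      hφ1 hψ1 (fun κ' h => hφγ κ' (h.trans_lt hκ)) (fun κ' h => hψγ κ' (h.trans_lt hκ))
      ((mem_upTo_of_rep ht).mpr le_rfl)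

/-- Each positivity condition involves finitely many quotients, and these already lie in one `Σ_ν`
or are all trivial. -/
theorem posDefOn_classUnion {S : Set (Cls m)} (hφ1 : φ 1 = 1)
    (hφ : ∀ ν ∈ S, PosDefOn (upTo ν) φ) : PosDefOn (classUnion S) φ := by
  intro k s _ hs'
  rcases finset_subset_classUnion
    (Finset.univ.image fun p : Fin k × Fin k => (s p.1)⁻¹ * s p.2)
    (Finset.forall_mem_image.mpr fun p _ => hs' p.1 p.2) with h | ⟨ν, hνS, h⟩
  · have h1 : ∀ i j, (s i)⁻¹ * s j = 1 := fun i j =>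
      Finset.forall_mem_image.mp h (Finset.mem_univ (i, j))
    refine isPositive_blockOp_of_gram (fun _ => (1 : H →L[ℂ] H)) (fun _ => (0 : H →L[ℂ] H)) ?_
    intro i j h k
    rw [h1, hφ1]
    simp
  · have h1 : ∀ i j, (s i)⁻¹ * s j ∈ upTo ν := fun i j =>
      Finset.forall_mem_image.mp h (Finset.mem_univ (i, j))
    exact (hφ ν hνS).isPositive s h1

/-- Functions on the sets `Σ_ν`, `ν ∈ S`, with the parameters `γ` are restrictions of one
function. -/
theorem exists_glue {S : Set (Cls m)} (hS : IsLowerSet S)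
    (h : ∀ ν ∈ S, ∃ φ : FG m → (H →L[ℂ] H), PosDefOn (upTo ν) φ ∧ φ 1 = 1 ∧
      ∀ κ ≤ ν, IsParameter φ κ (γ κ)) :
    ∃ φ : FG m → (H →L[ℂ] H), PosDefOn (classUnion S) φ ∧ φ 1 = 1 ∧
      ∀ κ ∈ S, IsParameter φ κ (γ κ) := by
  classical
  choose! f hf hf1 hfγ using h
  -- Each element takes its value from the function chosen for its own class; uniqueness makes this
  -- agree with all later choices. The default `1` is the normalization at `e` and is irrelevant
  -- outside `classUnion S`.
  let φ : FG m → (H →L[ℂ] H) := fun t =>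
    if ht : ∃ ν ∈ S, t = ν.1 ∨ t = ν.1⁻¹ then f ht.choose t else 1
  have hφ1 : φ 1 = 1 := by
    refine dif_neg ?_
    rintro ⟨ν, -, hν | hν⟩
    · exact ν.2.1 hν.symm
    · exact ν.2.1 (inv_eq_one.mp hν.symm)
  have heq : ∀ ν ∈ S, Set.EqOn (f ν) φ (upTo ν) := by
    intro ν hνS t ht
    by_cases ht' : ∃ ν ∈ S, t = ν.1 ∨ t = ν.1⁻¹
    · have hφt : φ t = f ht'.choose t := dif_pos ht'
      obtain ⟨hκS, hκ⟩ := ht'.choose_spec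
      have hle := (mem_upTo_of_rep hκ).mp ht
      rw [hφt]
      exact eqOn_of_isParameter ((hf ν hνS).mono (upTo_mono hle)) (hf _ hκS) (hf1 ν hνS)
        (hf1 _ hκS) (fun κ' h => hfγ ν hνS κ' (h.trans hle)) (hfγ _ hκS)
        ((mem_upTo_of_rep hκ).mpr le_rfl)
    · have ht1 : t = 1 := by
        by_contra ht1
        obtain ⟨κ, hκ⟩ := exists_rep t ht1
        exact ht' ⟨κ, hS ((mem_upTo_of_rep hκ).mp ht) hνS, hκ⟩
      rw [ht1, hf1 ν hνS, hφ1]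
  exact ⟨φ, posDefOn_classUnion hφ1 fun ν hν => (hf ν hν).congr (heq ν hν), hφ1,
    fun κ hκ => (hfγ κ hκ κ le_rfl).congr (heq κ hκ)⟩

/-- The spaces between which `γ_μ` has to act are known only once a function with the earlier
parameters exists. The induction supplies it by gluing, the hypothesis is applied to this very
function, and `γ_μ` then extends it by one class. -/
theorem exists_of_isContractionSeq (hγ : IsContractionSeq γ) (μ : Cls m) :
    ∃ φ : FG m → (H →L[ℂ] H), PosDefOn (upTo μ) φ ∧ φ 1 = 1 ∧
      ∀ κ ≤ μ, IsParameter φ κ (γ κ) := by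
  induction μ using WellFoundedLT.induction with
  | ind μ ih =>
    obtain ⟨φ, hφ, hφ1, hφγ⟩ := exists_glue (isLowerSet_Iio μ) ih
    rw [← below_eq_classUnion] at hφ
    obtain ⟨hb, hn⟩ := hγ μ φ hφ hφ1 hφγ
    obtain ⟨ψ, heq, hψ, hψμ⟩ := exists_extension hφ hb hn
    refine ⟨ψ, hψ, by rw [← heq (one_mem_below μ), hφ1], fun κ hκ => ?_⟩
    rcases hκ.lt_or_eq with hκ | rfl
    · exact (hφγ κ hκ).congr (heq.mono (upTo_subset_below hκ))
    · exact hψμ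

end Gluing

end FreeGroupPD

/-! ### The correspondence -/

theorem theorem4p5 (m : ℕ) [LinearOrder (FreeGroup (Fin m))] [FreeGroupPD.IsLexicographic m]
    (H : Type*) [NormedAddCommGroup H] [InnerProductSpace ℂ H] [CompleteSpace H] :
    (∀ Φ : FreeGroup (Fin m) → (H →L[ℂ] H), FreeGroupPD.PosDefOn Set.univ Φ → Φ 1 = 1 →
      ∃! γ : FreeGroupPD.OpSeq m H,
        FreeGroupPD.IsContractionSeq γ ∧ ∀ μ, FreeGroupPD.IsParameter Φ μ (γ μ)) ∧
    (∀ γ : FreeGroupPD.OpSeq m H, FreeGroupPD.IsContractionSeq γ →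
      ∃! Φ : FreeGroup (Fin m) → (H →L[ℂ] H),
        (FreeGroupPD.PosDefOn Set.univ Φ ∧ Φ 1 = 1) ∧
          ∀ μ, FreeGroupPD.IsParameter Φ μ (γ μ)) := by
  refine ⟨fun Φ hΦ hΦ1 => ?_, fun γ hγ => ?_⟩
  · have hex : ∀ μ : FreeGroupPD.Cls m, ∃ g, FreeGroupPD.IsParameter Φ μ g ∧ ‖g‖ ≤ 1 := fun μ =>
      FreeGroupPD.exists_isParameter (hΦ.mono (Set.subset_univ _)).isPositive_clique
    choose γ hγ hγ1 using hex
    refine ⟨γ, ⟨fun μ φ hφ hφ1 hφγ => ?_, hγ⟩, fun γ' h => funext fun μ => (h.2 μ).unique (hγ μ)⟩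
    -- Any `φ` with the earlier parameters of `Φ` agrees with `Φ` before `μ`, so its spaces `𝐃` and
    -- `𝐑` are those of `Φ`.
    have heq := FreeGroupPD.eqOn_below_of_isParameter hφ (hΦ.mono (Set.subset_univ _)) hφ1 hΦ1 hφγ
      fun κ _ => hγ κ
    rw [FreeGroupPD.domSpace_congr heq, FreeGroupPD.ranSpace_congr heq]
    exact ⟨(hγ μ).1, hγ1 μ⟩
  · obtain ⟨Φ, hΦ, hΦ1, hΦγ⟩ := FreeGroupPD.exists_glue isLowerSet_univ fun ν _ =>
      FreeGroupPD.exists_of_isContractionSeq hγ ν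
    rw [FreeGroupPD.classUnion_univ] at hΦ
    refine ⟨Φ, ⟨⟨hΦ, hΦ1⟩, fun μ => hΦγ μ trivial⟩, ?_⟩
    rintro Ψ ⟨⟨hΨ, hΨ1⟩, hΨγ⟩
    funext t
    have ht : t ∈ FreeGroupPD.classUnion (Set.univ : Set (FreeGroupPD.Cls m)) := by
      rw [FreeGroupPD.classUnion_univ]
      trivial
    rcases ht with rfl | ⟨κ, -, hκ⟩
    · rw [hΨ1, hΦ1]
    · exact FreeGroupPD.eqOn_of_isParameter (hΨ.mono (Set.subset_univ _))
        (hΦ.mono (Set.subset_univ _)) hΨ1 hΦ1 (fun κ _ => hΨγ κ) (fun κ _ => hΦγ κ trivial)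
        ((FreeGroupPD.mem_upTo_of_rep hκ).mpr le_rfl)
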